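/- Let $N,M\ge 1$ and let $\Omega\subset\mathbb R^N$ be a bounded, connected, nonempty open set. For $F=\mathbb R$ or $F=\mathbb R^M$ let $H^1_0(\Omega,F)$ be the closure of $C_c^\infty(\Omega,F)$ in $H^1(\Omega,F)$, and let the Dirichlet Laplacian on $L^2(\Omega,F)$ be the operator defined as follows: $u$ belongs to its domain and is mapped to $f\in L^2(\Omega,F)$ iff $u\in H^1_0(\Omega,F)$ and $$\sum_{j=1}^N\int_\Omega\langle\partial_j u,\partial_j v\rangle\,dx=\int_\Omega\langle f,v\rangle\,dx\qquad\text{for all }v\in H_0^1(\Omega,F).$$ Let $\lambda_1$ be the first (smallest) eigenvalue of the Dirichlet Laplacian on $L^2(\Omega,\mathbb R)$. Let $E=L^2(\Omega,\mathbb R^M)$, let $A\colon E\supset D(A)\to E$ be the Dirichlet Laplacian on $E$, and let $K=\{u\in E\mid u_i(x)\ge 0\text{ for a.a. }x\in\Omega,\ i=1,\dots,M\}$. Let $D=[d_{ij}]$ be a real $M\times M$ matrix that is quasi-nonnegative, i.e., $d_{ij}\ge 0$ for $i\ne j$, and let $G\colon E\to E$, $G(u)(x)=Du(x)$. Put $$\sigma_+(D)=\{\lambda\in\mathbb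 R\mid Dv=\lambda v\text{ for some }0\ne v\in\mathbb R^M_+\},\qquad s(D)=\max\operatorname{Re}\sigma(D),$$ where $\mathbb R^M_+=[0,\infty)^M$ and $\sigma(D)$ is the complex spectrum of $D$. If $\lambda_1\notin\sigma_+(D)$, then $\ker(A-G)\cap K=\{0\}$, that is, $u=0$ is the only $u\in D(A)\cap K$ with $Au=G(u)$. If, additionally, $s(D)>\lambda_1$, then there is $\bar u\in K$ such that $(A-G)^{-1}(\bar u)\cap K=\emptyset$, that is, no $u\in D(A)\cap K$ satisfies $Au-G(u)=\bar u$. -/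

import Mathlib

open MeasureTheory TopologicalSpace
open scoped Distributions LineDeriv ContDiff

namespace DirichletSystem

noncomputable section

/-- The Euclidean space `ℝ^N`. -/
abbrev Space (N : ℕ) : Type := EuclideanSpace ℝ (Fin N)

/-- The space `L²(Ω, F)` with respect to Lebesgue measure on `Ω`. -/
abbrev L2 {N : ℕ} (Ω : Opens (Space N)) (F : Type*) [NormedAddCommGroup F] :=
  Lp F 2 (volume.restrict (Ω : Set (Space N)))

section Sobolev

variable {N : ℕ} (Ω : Opens (Space N))
  (F : Type*) [NormedAddCommGroup F] [InnerProductSpace ℝ F]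

/-- The `j`-th standard basis vector of `ℝ^N`. -/
def basisVec (j : Fin N) : Space N := EuclideanSpace.single j 1

theorem testFunction_memLp (ψ : 𝓓(Ω, F)) :
    MemLp ψ 2 (volume.restrict (Ω : Set (Space N))) :=
  ψ.continuous.memLp_of_hasCompactSupport ψ.hasCompactSupport

/-- The inclusion `C_c^∞(Ω, F) → L²(Ω, F)`. -/
def testToL2 : 𝓓(Ω, F) →ₗ[ℝ] L2 Ω F where
  toFun ψ := (testFunction_memLp Ω F ψ).toLp ψ
  map_add' _ _ := rfl
  map_smul' _ _ := rfl

/-- `g` is the `j`-th weak partial derivative of `u` on `Ω`: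
`∫_Ω (∂_j η) u = - ∫_Ω η g` for every `η ∈ C_c^∞(Ω)`. -/
def IsWeakPartialDeriv {Ω : Opens (Space N)} {F : Type*} [NormedAddCommGroup F]
    [InnerProductSpace ℝ F] (j : Fin N) (u g : L2 Ω F) : Prop :=
  ∀ η : 𝓓(Ω, ℝ),
    ∫ x in (Ω : Set (Space N)), (lineDeriv ℝ η x (basisVec j)) • u x =
      - ∫ x in (Ω : Set (Space N)), η x • g x

theorem integrable_testFunction_smul (η : 𝓓(Ω, ℝ)) (u : L2 Ω F) :
    Integrable (fun x => η x • u x) (volume.restrict (Ω : Set (Space N))) :=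
  memLp_one_iff_integrable.1
    ((Lp.memLp u).smul (p := 2) (q := 2) (r := 1) (testFunction_memLp Ω ℝ η))

theorem lineDeriv_testFunction (ψ : 𝓓(Ω, F)) (j : Fin N) (x : Space N) :
    lineDeriv ℝ ψ x (basisVec j) = (TestFunction.lineDerivCLM ℝ (basisVec j) ψ : 𝓓(Ω, F)) x :=
  (TestFunction.lineDerivCLM_apply_of_le (by simp)).symm

/-- The Sobolev space `H¹(Ω, F)`, each element `u` being recorded together with its weak gradient,
as the pair `(u, (∂_1 u, …, ∂_N u))`. The topology of `L² × (L²)^N` restricts to the topology of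
the `H¹` norm. -/
def H1 : Submodule ℝ (L2 Ω F × (Fin N → L2 Ω F)) where
  carrier := {p | ∀ j, IsWeakPartialDeriv j p.1 (p.2 j)}
  zero_mem' := by
    intro j η
    have h0 : ∀ᵐ x ∂(volume.restrict (Ω : Set (Space N))), (0 : L2 Ω F) x = 0 :=
      Lp.coeFn_zero F 2 _
    rw [integral_eq_zero_of_ae, integral_eq_zero_of_ae, neg_zero]
    · filter_upwards [h0] with x hx
      change _ • (0 : L2 Ω F) x = 0
      rw [hx, smul_zero]
    · filter_upwards [h0] with x hx
      change _ • (0 : L2 Ω F) x = 0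
      rw [hx, smul_zero]
  add_mem' := by
    intro p q hp hq j η
    have h1 := Lp.coeFn_add p.1 q.1
    have h2 := Lp.coeFn_add (p.2 j) (q.2 j)
    have e1 := hp j η
    have e2 := hq j η
    simp only [lineDeriv_testFunction] at e1 e2 ⊢
    rw [integral_congr_ae (g := fun x =>
        (TestFunction.lineDerivCLM ℝ (basisVec j) η : 𝓓(Ω, ℝ)) x • p.1 x
          + (TestFunction.lineDerivCLM ℝ (basisVec j) η : 𝓓(Ω, ℝ)) x • q.1 x),
      integral_congr_ae (f := fun x => η x • (p + q).2 j x)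
        (g := fun x => η x • p.2 j x + η x • q.2 j x),
      integral_add (integrable_testFunction_smul Ω F _ _) (integrable_testFunction_smul Ω F _ _),
      integral_add (integrable_testFunction_smul Ω F _ _) (integrable_testFunction_smul Ω F _ _),
      e1, e2, neg_add]
    · filter_upwards [h2] with x hx
      simp only [Prod.snd_add, Pi.add_apply] at hx ⊢
      rw [hx, smul_add]
    · filter_upwards [h1] with x hx
      simp only [Prod.fst_add, Pi.add_apply] at hx ⊢
      rw [hx, smul_add]
  smul_mem' := by
    intro c p hp j η
    have h1 := Lp.coeFn_smul c p.1
    have h2 := Lp.coeFn_smul c (p.2 j)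
    have e1 := hp j η
    rw [integral_congr_ae (g := fun x => c • (lineDeriv ℝ η x (basisVec j) • p.1 x)),
      integral_congr_ae (f := fun x => η x • (c • p).2 j x) (g := fun x => c • (η x • p.2 j x)),
      integral_smul, integral_smul, e1, smul_neg]
    · filter_upwards [h2] with x hx
      simp only [Prod.smul_snd, Pi.smul_apply] at hx ⊢
      rw [hx, smul_comm]
    · filter_upwards [h1] with x hx
      simp only [Prod.smul_fst, Pi.smul_apply] at hx ⊢
      rw [hx, smul_comm]

/-- The map `ψ ↦ (ψ, (∂_1 ψ, …, ∂_N ψ))` on `C_c^∞(Ω, F)`. -/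
def testWithGradient : 𝓓(Ω, F) →ₗ[ℝ] L2 Ω F × (Fin N → L2 Ω F) :=
  (testToL2 Ω F).prod (LinearMap.pi fun j =>
    testToL2 Ω F ∘ₗ (TestFunction.lineDerivCLM ℝ (basisVec j) : 𝓓(Ω, F) →L[ℝ] 𝓓(Ω, F)).toLinearMap)

/-- The space `H¹₀(Ω, F)`: the closure of `C_c^∞(Ω, F)` in `H¹(Ω, F)`. -/
def H10 : Submodule ℝ (L2 Ω F × (Fin N → L2 Ω F)) :=
  H1 Ω F ⊓ (LinearMap.range (testWithGradient Ω F)).topologicalClosure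

/-- The graph of the Dirichlet realization of `-Δ` in `L²(Ω, F)`: `(u, f)` belongs to it iff
`u ∈ H¹₀(Ω, F)` and `∑_j ⟨∂_j u, ∂_j v⟩ = ⟨f, v⟩` in `L²(Ω, F)` for every `v ∈ H¹₀(Ω, F)`. -/
def laplacianGraph : Submodule ℝ (L2 Ω F × L2 Ω F) where
  carrier := {q | ∃ g : Fin N → L2 Ω F, (q.1, g) ∈ H10 Ω F ∧
    ∀ p ∈ H10 Ω F, ∑ j, inner ℝ (g j) (p.2 j) = inner ℝ q.2 p.1}
  zero_mem' := ⟨0, (H10 Ω F).zero_mem, by simp⟩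
  add_mem' := by
    rintro a b ⟨g, hg, hg'⟩ ⟨h, hh, hh'⟩
    refine ⟨g + h, (H10 Ω F).add_mem hg hh, fun p hp => ?_⟩
    simp [inner_add_left, Finset.sum_add_distrib, hg' p hp, hh' p hp]
  smul_mem' := by
    rintro c a ⟨g, hg, hg'⟩
    refine ⟨c • g, (H10 Ω F).smul_mem c hg, fun p hp => ?_⟩
    simp [inner_smul_left, ← Finset.mul_sum, hg' p hp]

/-- The operator `A = -Δ` in `L²(Ω, F)` with Dirichlet boundary condition, defined by the form
`∑_j ⟨∂_j u, ∂_j v⟩` on `H¹₀(Ω, F)`. -/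
def dirichletLaplacian : L2 Ω F →ₗ.[ℝ] L2 Ω F :=
  (laplacianGraph Ω F).toLinearPMap

theorem testWithGradient_mem_H10 [CompleteSpace F] (ψ : 𝓓(Ω, F)) :
    testWithGradient Ω F ψ ∈ H10 Ω F := by
  refine ⟨fun j η => ?_, Submodule.le_topologicalClosure _ ⟨ψ, rfl⟩⟩
  have h1 : ∀ᵐ x ∂(volume.restrict (Ω : Set (Space N))), testToL2 Ω F ψ x = ψ x :=
    (testFunction_memLp Ω F ψ).coeFn_toLp
  have h2 : ∀ᵐ x ∂(volume.restrict (Ω : Set (Space N))),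
      (testWithGradient Ω F ψ).2 j x = lineDeriv ℝ ψ x (basisVec j) := by
    filter_upwards [(testFunction_memLp Ω F
      (TestFunction.lineDerivCLM ℝ (basisVec j) ψ : 𝓓(Ω, F))).coeFn_toLp] with x hx
    rw [lineDeriv_testFunction]
    exact hx
  have hz : ∀ x, x ∉ (Ω : Set (Space N)) → η x = 0 := fun x hx =>
    image_eq_zero_of_notMem_tsupport fun h => hx (η.tsupport_subset h)
  have hz' : ∀ x, x ∉ (Ω : Set (Space N)) → lineDeriv ℝ η x (basisVec j) = 0 := fun x hx => by
    rw [lineDeriv_testFunction]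
    exact image_eq_zero_of_notMem_tsupport fun h => hx (TestFunction.tsupport_subset _ h)
  rw [integral_congr_ae (g := fun x => lineDeriv ℝ η x (basisVec j) • ψ x),
    integral_congr_ae (f := fun x => η x • (testWithGradient Ω F ψ).2 j x)
      (g := fun x => η x • lineDeriv ℝ ψ x (basisVec j)),
    setIntegral_eq_integral_of_forall_compl_eq_zero (fun x hx => by simp [hz' x hx]),
    setIntegral_eq_integral_of_forall_compl_eq_zero (fun x hx => by simp [hz x hx])]
  · have hd : ∀ x, lineDeriv ℝ η x (basisVec j) = fderiv ℝ η x (basisVec j) := fun x =>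
      (η.contDiff.differentiable (by simp)).differentiableAt.lineDeriv_eq_fderiv
    have hd' : ∀ x, lineDeriv ℝ ψ x (basisVec j) = fderiv ℝ ψ x (basisVec j) := fun x =>
      (ψ.contDiff.differentiable (by simp)).differentiableAt.lineDeriv_eq_fderiv
    have hc : Continuous fun x => lineDeriv ℝ η x (basisVec j) := by
      simp only [lineDeriv_testFunction]; fun_prop
    have hc' : Continuous fun x => lineDeriv ℝ ψ x (basisVec j) := by
      simp only [lineDeriv_testFunction]; fun_prop
    have hs : HasCompactSupport fun x => lineDeriv ℝ η x (basisVec j) := by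
      simp only [lineDeriv_testFunction]; exact TestFunction.hasCompactSupport _
    have i1 : Integrable (fun x => lineDeriv ℝ η x (basisVec j) • ψ x) :=
      (hc.smul ψ.continuous).integrable_of_hasCompactSupport hs.smul_right
    have i2 : Integrable (fun x => η x • lineDeriv ℝ ψ x (basisVec j)) :=
      (η.continuous.smul hc').integrable_of_hasCompactSupport η.hasCompactSupport.smul_right
    have i3 : Integrable (fun x => η x • ψ x) :=
      (η.continuous.smul ψ.continuous).integrable_of_hasCompactSupport
        η.hasCompactSupport.smul_right
    simp only [hd, hd'] at i1 i2 ⊢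
    have := integral_smul_fderiv_eq_neg_fderiv_smul_of_integrable i1 i2 i3
      (fun x _ => (η.contDiff.differentiable (by simp)).differentiableAt)
      (fun x _ => (ψ.contDiff.differentiable (by simp)).differentiableAt)
    rw [this, neg_neg]
  · filter_upwards [h2] with x hx
    rw [hx]
  · filter_upwards [h1] with x hx
    change _ • testToL2 Ω F ψ x = _
    rw [hx]

theorem eq_zero_of_integral_test {Ω : Opens (Space N)} {F : Type*} [NormedAddCommGroup F]
    [InnerProductSpace ℝ F] [CompleteSpace F] (f : L2 Ω F)
    (h : ∀ η : 𝓓(Ω, ℝ), ∫ x in (Ω : Set (Space N)), η x • f x = 0) : f = 0 := by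
  have hloc : LocallyIntegrableOn (f : Space N → F) (Ω : Set (Space N)) :=
    (locallyIntegrableOn_of_locallyIntegrable_restrict
      ((Lp.memLp f).locallyIntegrable (by norm_num)))
  have := Ω.isOpen.ae_eq_zero_of_integral_contDiff_smul_eq_zero hloc fun g hg hc hs => by
    rw [← h ⟨g, hg, hc, hs⟩]
    refine (setIntegral_eq_integral_of_forall_compl_eq_zero fun x hx => ?_).symm
    have : g x = 0 := image_eq_zero_of_notMem_tsupport fun h => hx (hs h)
    simp [this]
  refine (Lp.eq_zero_iff_ae_eq_zero).2 ?_
  exact (ae_restrict_iff' Ω.isOpen.measurableSet).2 this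

/-- The graph of the Dirichlet Laplacian is single valued. -/
theorem laplacianGraph_functional [CompleteSpace F] (q : L2 Ω F × L2 Ω F)
    (hq : q ∈ laplacianGraph Ω F) (h0 : q.1 = 0) : q.2 = 0 := by
  obtain ⟨g, hg, hgq⟩ := hq
  have hg0 : g = 0 := by
    funext j
    refine eq_zero_of_integral_test _ fun η => ?_
    have h := hg.1 j η
    rw [integral_eq_zero_of_ae, eq_comm, neg_eq_zero] at h
    · exact h
    · filter_upwards [Lp.coeFn_zero F 2 (volume.restrict (Ω : Set (Space N)))] with x hx
      simp only [h0]
      rw [hx]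
      simp
  refine eq_zero_of_integral_test _ fun η => ?_
  refine ext_inner_right ℝ fun c => ?_
  have hψ : ∃ ψ : 𝓓(Ω, F), ∀ x, ψ x = η x • c :=
    ⟨⟨fun x => η x • c, η.contDiff.smul contDiff_const, η.hasCompactSupport.smul_right,
      (tsupport_smul_subset_left _ _).trans η.tsupport_subset⟩, fun _ => rfl⟩
  obtain ⟨ψ, hψ⟩ := hψ
  have h := hgq _ (testWithGradient_mem_H10 Ω F ψ)
  rw [hg0] at h
  simp only [Pi.zero_apply, inner_zero_left, Finset.sum_const_zero] at h
  rw [inner_zero_left, real_inner_comm,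
    ← integral_inner (integrable_testFunction_smul Ω F η q.2) c, h, L2.inner_def]
  refine integral_congr_ae ?_
  filter_upwards [(testFunction_memLp Ω F ψ).coeFn_toLp] with x hx
  have hx' : (testWithGradient Ω F ψ).1 x = η x • c := by
    rw [← hψ]
    exact hx
  rw [hx', inner_smul_right, inner_smul_right, real_inner_comm]

/-- `u ∈ D(A)` and `A u = f` iff `(u, f)` belongs to `laplacianGraph Ω F`. -/
theorem dirichletLaplacian_graph [CompleteSpace F] :
    (dirichletLaplacian Ω F).graph = laplacianGraph Ω F :=
  Submodule.toLinearPMap_graph_eq _ (laplacianGraph_functional Ω F)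

end Sobolev

/-- The first eigenvalue `λ₁` of the scalar Dirichlet Laplacian on `Ω`. -/
def firstEigenvalue {N : ℕ} (Ω : Opens (Space N)) : ℝ :=
  sInf {l : ℝ | ∃ φ : (dirichletLaplacian Ω ℝ).domain,
    (φ : L2 Ω ℝ) ≠ 0 ∧ dirichletLaplacian Ω ℝ φ = l • (φ : L2 Ω ℝ)}

/-- The cone `K` of the functions in `L²(Ω, ℝ^M)` with nonnegative components. -/
def cone {N : ℕ} (Ω : Opens (Space N)) (M : ℕ) : Set (L2 Ω (Space M)) :=
  {u | ∀ᵐ x ∂(volume.restrict (Ω : Set (Space N))), ∀ i, 0 ≤ u x i}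

/-- The Nemytskii operator `G` of the matrix `D`, `G(u)(x) = D u(x)`. -/
def nemytskii {N M : ℕ} (Ω : Opens (Space N)) (D : Matrix (Fin M) (Fin M) ℝ) :
    L2 Ω (Space M) →L[ℝ] L2 Ω (Space M) :=
  (Matrix.toEuclideanCLM (𝕜 := ℝ) D).compLpL 2 (volume.restrict (Ω : Set (Space N)))

/-- The set `(A - G)⁻¹(w)` of all `u ∈ D(A)` with `A u - G(u) = w`. -/
def solutions {N M : ℕ} (Ω : Opens (Space N)) (D : Matrix (Fin M) (Fin M) ℝ)
    (w : L2 Ω (Space M)) : Set (L2 Ω (Space M)) :=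
  {u | ∃ hu : u ∈ (dirichletLaplacian Ω (Space M)).domain,
    dirichletLaplacian Ω (Space M) ⟨u, hu⟩ - nemytskii Ω D u = w}

/-- `D` is quasi-nonnegative: its off-diagonal entries are nonnegative. -/
def QuasiNonneg {M : ℕ} (D : Matrix (Fin M) (Fin M) ℝ) : Prop :=
  ∀ i j, i ≠ j → 0 ≤ D i j

/-- The set `σ₊(D)` of the real eigenvalues of `D` with an eigenvector in `ℝ^M_+`. -/
def sigmaPlus {M : ℕ} (D : Matrix (Fin M) (Fin M) ℝ) : Set ℝ :=
  {l | ∃ v : Fin M → ℝ, v ≠ 0 ∧ (∀ i, 0 ≤ v i) ∧ D.mulVec v = l • v}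

/-- The spectral bound `s(D) = max Re σ(D)`, where `σ(D)` is the complex spectrum. -/
def spectralBound {M : ℕ} (D : Matrix (Fin M) (Fin M) ℝ) : ℝ :=
  sSup (Complex.re '' spectrum ℂ (D.map Complex.ofReal))

end

end DirichletSystem

open DirichletSystem

/-!
Rellich's theorem and the direct method give a minimizer of the Rayleigh quotient; a smooth
approximation of the absolute value makes it a nonnegative eigenfunction `φ` for `λ₁`. Being weakly
superharmonic, `φ` has weighted means over balls that increase as the radius shrinks, so `φ`
vanishes near every point in whose vicinity it vanishes on a set of positive measure, and
connectedness of `Ω` leaves only `φ > 0` almost everywhere.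

Testing `A u = D u + w` with `φ` in each component shows that `v = (⟨u_i, φ⟩)_i` satisfies
`D v + (⟨w_i, φ⟩)_i = λ₁ v`, and `v ≥ 0` if `u ∈ K`. For `w = 0` either `v = 0`, hence `u = 0`, or
`λ₁ ∈ σ₊(D)`. For `w = (φ, …, φ)` it gives `D v < λ₁ v` in every component, which for a
quasi-nonnegative `D` implies `s(D) ≤ λ₁`.
-/

namespace DirichletSystem

section Sobolev

variable {N : ℕ} {Ω : Opens (Space N)} {F G : Type*} [NormedAddCommGroup F]
  [InnerProductSpace ℝ F] [NormedAddCommGroup G] [InnerProductSpace ℝ G]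

/-- The `j`-th partial derivative of a test function, again as a test function. -/
noncomputable def partialDeriv (j : Fin N) (ψ : 𝓓(Ω, F)) : 𝓓(Ω, F) :=
  TestFunction.lineDerivCLM ℝ (basisVec j) ψ

theorem differentiable_testFunction (ψ : 𝓓(Ω, F)) : Differentiable ℝ ψ :=
  ψ.contDiff.differentiable (by simp)

theorem partialDeriv_apply (j : Fin N) (ψ : 𝓓(Ω, F)) (x : Space N) :
    partialDeriv j ψ x = fderiv ℝ ψ x (basisVec j) := by
  rw [partialDeriv, ← lineDeriv_testFunction]
  exact (differentiable_testFunction ψ x).lineDeriv_eq_fderiv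

theorem testFunction_eq_zero (ψ : 𝓓(Ω, F)) {x : Space N} (hx : x ∉ (Ω : Set (Space N))) :
    ψ x = 0 :=
  image_eq_zero_of_notMem_tsupport fun h => hx (ψ.tsupport_subset h)

theorem coeFn_testToL2 (ψ : 𝓓(Ω, F)) :
    ∀ᵐ x ∂(volume.restrict (Ω : Set (Space N))), testToL2 Ω F ψ x = ψ x :=
  (testFunction_memLp Ω F ψ).coeFn_toLp

theorem testWithGradient_fst (ψ : 𝓓(Ω, F)) : (testWithGradient Ω F ψ).1 = testToL2 Ω F ψ := rfl

theorem testWithGradient_snd (ψ : 𝓓(Ω, F)) (j : Fin N) :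
    (testWithGradient Ω F ψ).2 j = testToL2 Ω F (partialDeriv j ψ) := rfl

theorem compLp_testToL2 (T : F →L[ℝ] G) (ψ : 𝓓(Ω, F)) :
    T.compLp (testToL2 Ω F ψ) = testToL2 Ω G (TestFunction.postcompCLM T ψ) := by
  ext1
  filter_upwards [T.coeFn_compLp (testToL2 Ω F ψ), coeFn_testToL2 ψ,
    coeFn_testToL2 (TestFunction.postcompCLM T ψ)] with x h₁ h₂ h₃
  rw [h₁, h₂, h₃, TestFunction.postcompCLM_apply, Function.comp_apply]

theorem partialDeriv_postcompCLM (T : F →L[ℝ] G) (j : Fin N) (ψ : 𝓓(Ω, F)) :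
    partialDeriv j (TestFunction.postcompCLM T ψ : 𝓓(Ω, G)) =
      TestFunction.postcompCLM T (partialDeriv j ψ) := by
  ext x
  rw [partialDeriv_apply, TestFunction.postcompCLM_apply, TestFunction.postcompCLM_apply,
    fderiv_comp x T.differentiableAt (differentiable_testFunction ψ x), T.fderiv,
    Function.comp_apply, partialDeriv_apply, ContinuousLinearMap.comp_apply]

theorem continuous_integral_testFunction_smul [CompleteSpace F] (η : 𝓓(Ω, ℝ)) :
    Continuous fun u : L2 Ω F => ∫ x in (Ω : Set (Space N)), η x • u x := by
  refine (((ContinuousLinearMap.lsmul ℝ ℝ : ℝ →L[ℝ] F →L[ℝ] F).lpPairing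
    (volume.restrict (Ω : Set (Space N))) 2 2) (testToL2 Ω ℝ η)).continuous.congr fun u => ?_
  rw [ContinuousLinearMap.lpPairing_eq_integral]
  refine integral_congr_ae ?_
  filter_upwards [coeFn_testToL2 η] with x hx
  rw [hx, ContinuousLinearMap.lsmul_apply]

theorem isClosed_H1 [CompleteSpace F] :
    IsClosed (H1 Ω F : Set (L2 Ω F × (Fin N → L2 Ω F))) := by
  have hcarrier : (H1 Ω F : Set (L2 Ω F × (Fin N → L2 Ω F))) = ⋂ (j) (η : 𝓓(Ω, ℝ)),
      {p | ∫ x in (Ω : Set (Space N)), partialDeriv j η x • p.1 x =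
        - ∫ x in (Ω : Set (Space N)), η x • p.2 j x} := by
    ext p
    simp only [Set.mem_iInter, Set.mem_ofPred_eq, partialDeriv, ← lineDeriv_testFunction]
    rfl
  rw [hcarrier]
  refine isClosed_iInter fun j => isClosed_iInter fun η => isClosed_eq ?_ ?_
  · exact (continuous_integral_testFunction_smul _).comp continuous_fst
  · exact ((continuous_integral_testFunction_smul η).comp
      ((continuous_apply j).comp continuous_snd)).neg

theorem H10_eq_topologicalClosure [CompleteSpace F] :
    H10 Ω F = (LinearMap.range (testWithGradient Ω F)).topologicalClosure := by
  refine inf_eq_right.2 (Submodule.topologicalClosure_minimal _ ?_ isClosed_H1)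
  rintro _ ⟨ψ, rfl⟩
  exact (testWithGradient_mem_H10 Ω F ψ).1

theorem isClosed_H10 [CompleteSpace F] :
    IsClosed (H10 Ω F : Set (L2 Ω F × (Fin N → L2 Ω F))) :=
  isClosed_H1.inter (Submodule.isClosed_topologicalClosure _)

theorem H10_induction [CompleteSpace F] {P : L2 Ω F × (Fin N → L2 Ω F) → Prop}
    (hclosed : IsClosed {p | P p}) (htest : ∀ ψ : 𝓓(Ω, F), P (testWithGradient Ω F ψ))
    {p : L2 Ω F × (Fin N → L2 Ω F)} (hp : p ∈ H10 Ω F) : P p := by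
  rw [H10_eq_topologicalClosure] at hp
  refine closure_minimal ?_ hclosed hp
  rintro _ ⟨ψ, rfl⟩
  exact htest ψ

theorem compLp_mem_H10 [CompleteSpace F] [CompleteSpace G] (T : F →L[ℝ] G)
    {p : L2 Ω F × (Fin N → L2 Ω F)} (hp : p ∈ H10 Ω F) :
    (T.compLp p.1, fun j => T.compLp (p.2 j)) ∈ H10 Ω G := by
  have hcont : Continuous fun p : L2 Ω F × (Fin N → L2 Ω F) =>
      (T.compLpL 2 (volume.restrict (Ω : Set (Space N))) p.1,
        fun j => T.compLpL 2 (volume.restrict (Ω : Set (Space N))) (p.2 j)) := by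
    fun_prop
  refine H10_induction (isClosed_H10.preimage hcont) (fun ψ => ?_) hp
  have htest : testWithGradient Ω G (TestFunction.postcompCLM T ψ) =
      (T.compLp (testToL2 Ω F ψ), fun j => T.compLp (testToL2 Ω F (partialDeriv j ψ))) := by
    refine Prod.ext (compLp_testToL2 T ψ).symm (funext fun j => ?_)
    rw [testWithGradient_snd, partialDeriv_postcompCLM]
    exact (compLp_testToL2 T _).symm
  have hmem := testWithGradient_mem_H10 Ω G (TestFunction.postcompCLM T ψ)
  rwa [htest] at hmem

end Sobolev

section Energy

variable {N : ℕ} {Ω : Opens (Space N)} {F : Type*} [NormedAddCommGroup F]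

/-- The Dirichlet energy `∑_j ‖∂_j u‖²` of an element of `H¹`, recorded with its gradient. -/
noncomputable def energy (p : L2 Ω F × (Fin N → L2 Ω F)) : ℝ := ∑ j, ‖p.2 j‖ ^ 2

theorem energy_nonneg (p : L2 Ω F × (Fin N → L2 Ω F)) : 0 ≤ energy p :=
  Finset.sum_nonneg fun _ _ => sq_nonneg _

theorem norm_sq_le_energy (p : L2 Ω F × (Fin N → L2 Ω F)) (j : Fin N) :
    ‖p.2 j‖ ^ 2 ≤ energy p :=
  Finset.single_le_sum (f := fun j => ‖p.2 j‖ ^ 2) (fun _ _ => sq_nonneg _) (Finset.mem_univ j)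

theorem continuous_energy : Continuous (energy : L2 Ω F × (Fin N → L2 Ω F) → ℝ) := by
  unfold energy
  fun_prop

variable [InnerProductSpace ℝ F]

theorem energy_smul (c : ℝ) (p : L2 Ω F × (Fin N → L2 Ω F)) :
    energy (c • p) = c ^ 2 * energy p := by
  simp only [energy, Prod.smul_snd, Pi.smul_apply, norm_smul, mul_pow, Real.norm_eq_abs, sq_abs,
    Finset.mul_sum]

theorem energy_add (p q : L2 Ω F × (Fin N → L2 Ω F)) :
    energy (p + q) = energy p + 2 * ∑ j, inner ℝ (p.2 j) (q.2 j) + energy q := by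
  simp only [energy, Prod.snd_add, Pi.add_apply, norm_add_sq_real, Finset.sum_add_distrib,
    Finset.mul_sum]

theorem energy_sub_add_energy_add (p q : L2 Ω F × (Fin N → L2 Ω F)) :
    energy (p - q) + energy (p + q) = 2 * (energy p + energy q) := by
  simp only [energy, ← Finset.sum_add_distrib, Finset.mul_sum, Prod.snd_sub, Prod.snd_add,
    Pi.sub_apply, Pi.add_apply]
  refine Finset.sum_congr rfl fun j _ => ?_
  linarith [parallelogram_law_with_norm ℝ (p.2 j) (q.2 j)]

end Energy

theorem isCompactOperator_of_forall_norm_sub_le {𝕜 V W : Type*} [NontriviallyNormedField 𝕜]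
    [NormedAddCommGroup V] [NormedSpace 𝕜 V] [NormedAddCommGroup W] [NormedSpace 𝕜 W]
    [CompleteSpace W] {S : V →L[𝕜] W}
    (h : ∀ ε > 0, ∃ T : V →L[𝕜] W, IsCompactOperator T ∧ ∀ x, ‖T x - S x‖ ≤ ε * ‖x‖) :
    IsCompactOperator S := by
  refine isClosed_setOfPred_isCompactOperator.closure_subset
    (Metric.mem_closure_iff.2 fun ε hε => ?_)
  obtain ⟨T, hT, hTS⟩ := h (ε / 2) (half_pos hε)
  refine ⟨T, hT, ?_⟩
  rw [dist_comm, dist_eq_norm]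
  exact (ContinuousLinearMap.opNorm_le_bound _ (half_pos hε).le hTS).trans_lt (half_lt_self hε)

section KernelOperator

variable {α E : Type*} [MeasurableSpace α] {μ : Measure α} [NormedAddCommGroup E]
  [NormedSpace ℝ E] {p : ENNReal} [Fact (1 ≤ p)]

/-- The operator `E → L^p(μ)`, `u ↦ (x ↦ k x u)`, attached to a kernel `k ∈ L^p(μ; E')`; it depends
linearly and continuously on the kernel. -/
noncomputable def kernelOperator : Lp (StrongDual ℝ E) p μ →L[ℝ] E →L[ℝ] Lp ℝ p μ :=
  LinearMap.mkContinuous₂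
    (LinearMap.mk₂ ℝ (fun k u => (ContinuousLinearMap.apply ℝ ℝ u).compLp k)
      (fun k₁ k₂ u => ((ContinuousLinearMap.apply ℝ ℝ u).compLpL p μ).map_add k₁ k₂)
      (fun c k u => ((ContinuousLinearMap.apply ℝ ℝ u).compLpL p μ).map_smul c k)
      (fun k u v => by rw [map_add, ContinuousLinearMap.add_compLp])
      (fun c k u => by rw [map_smul, ContinuousLinearMap.smul_compLp]))
    1 fun k u => by
      rw [one_mul, mul_comm]
      refine (ContinuousLinearMap.norm_compLp_le _ _).trans ?_
      gcongr
      exact ContinuousLinearMap.opNorm_le_bound _ (norm_nonneg u) fun f => by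
        simpa [mul_comm] using f.le_opNorm u

theorem coeFn_kernelOperator (k : Lp (StrongDual ℝ E) p μ) (u : E) :
    kernelOperator k u =ᵐ[μ] fun x => k x u :=
  (ContinuousLinearMap.apply ℝ ℝ u).coeFn_compLp k

theorem kernelOperator_indicatorConstLp {s : Set α} (hs : MeasurableSet s) (hμs : μ s ≠ ⊤)
    (c : StrongDual ℝ E) :
    kernelOperator (indicatorConstLp p hs hμs c) =
      c.smulRight (indicatorConstLp p hs hμs (1 : ℝ)) := by
  ext u
  filter_upwards [coeFn_kernelOperator (indicatorConstLp p hs hμs c) u,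
    indicatorConstLp_coeFn (p := p) (hs := hs) (hμs := hμs) (c := c),
    indicatorConstLp_coeFn (p := p) (hs := hs) (hμs := hμs) (c := (1 : ℝ)),
    Lp.coeFn_smul (c u) (indicatorConstLp p hs hμs (1 : ℝ))] with x h₁ h₂ h₃ h₄
  rw [h₁, h₂, ContinuousLinearMap.smulRight_apply, h₄, Pi.smul_apply, h₃]
  by_cases hx : x ∈ s <;> simp [hx]

theorem isCompactOperator_kernelOperator (hp : p ≠ ⊤) (k : Lp (StrongDual ℝ E) p μ) :
    IsCompactOperator (kernelOperator k) := by
  refine Lp.induction hp (fun k => IsCompactOperator (kernelOperator k)) (fun c s hs hμs => ?_)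
    (fun f g hf hg _ hTf hTg => ?_) ?_ k
  · rw [Lp.simpleFunc.coe_indicatorConst, kernelOperator_indicatorConstLp]
    exact (isCompactOperator_of_locallyCompactSpace_dom c).clm_comp
      (ContinuousLinearMap.toSpanSingleton ℝ _)
  · rw [map_add]
    exact hTf.add hTg
  · exact isClosed_setOfPred_isCompactOperator.preimage kernelOperator.continuous

end KernelOperator

section Translation

theorem sq_integral_mul_le {α : Type*} [MeasurableSpace α] {μ : Measure α} {ρ f : α → ℝ}
    (hρ₀ : ∀ x, 0 ≤ ρ x) (hρ₁ : ∫ x, ρ x ∂μ = 1) (hf : Integrable (fun x => ρ x * f x) μ)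
    (hf₂ : Integrable (fun x => ρ x * f x ^ 2) μ) :
    (∫ x, ρ x * f x ∂μ) ^ 2 ≤ ∫ x, ρ x * f x ^ 2 ∂μ := by
  have hρ : Integrable ρ μ := by
    by_contra h
    simp [integral_undef h] at hρ₁
  set m := ∫ x, ρ x * f x ∂μ
  have hvar : 0 ≤ ∫ x, ρ x * f x ^ 2 - 2 * m * (ρ x * f x) + m ^ 2 * ρ x ∂μ := by
    refine integral_nonneg fun x => ?_
    have hsq : ρ x * f x ^ 2 - 2 * m * (ρ x * f x) + m ^ 2 * ρ x = ρ x * (f x - m) ^ 2 := by ring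
    rw [Pi.zero_apply, hsq]
    exact mul_nonneg (hρ₀ x) (sq_nonneg _)
  have hint : Integrable (fun x => ρ x * f x ^ 2 - 2 * m * (ρ x * f x)) μ :=
    hf₂.sub (hf.const_mul _)
  rw [integral_add hint (hρ.const_mul _), integral_sub hf₂ (hf.const_mul _),
    integral_const_mul, integral_const_mul, hρ₁] at hvar
  linarith

section NormedSpace

variable {E : Type*} [NormedAddCommGroup E] [NormedSpace ℝ E] {f : E → ℝ}

theorem sub_translate_eq_integral (hf : ContDiff ℝ 1 f) (x y : E) :
    f (x - y) - f x = -∫ t in (0 : ℝ)..1, fderiv ℝ f (x - t • y) y := by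
  have := hf.continuous_fderiv one_ne_zero
  have hcont : Continuous fun t : ℝ => fderiv ℝ f (x - t • y) y := by fun_prop
  have hderiv (t : ℝ) : HasDerivAt (fun t : ℝ => f (x - t • y)) (-fderiv ℝ f (x - t • y) y) t := by
    have hline : HasDerivAt (fun t : ℝ => x - t • y) (-y) t := by
      simpa using ((hasDerivAt_id t).smul_const y).const_sub x
    rw [← map_neg]
    exact (hf.differentiable one_ne_zero _).hasFDerivAt.comp_hasDerivAt t hline
  have hftc := intervalIntegral.integral_eq_sub_of_hasDerivAt
    (fun t _ => hderiv t) (hcont.neg.intervalIntegrable 0 1)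
  simpa using hftc.symm

theorem sq_sub_translate_le (hf : ContDiff ℝ 1 f) (x y : E) :
    (f (x - y) - f x) ^ 2 ≤ ∫ t in (0 : ℝ)..1, fderiv ℝ f (x - t • y) y ^ 2 := by
  have := hf.continuous_fderiv one_ne_zero
  have hcont : Continuous fun t : ℝ => fderiv ℝ f (x - t • y) y := by fun_prop
  have hcont₂ : Continuous fun t : ℝ => fderiv ℝ f (x - t • y) y ^ 2 := by fun_prop
  rw [sub_translate_eq_integral hf, neg_sq]
  simp only [intervalIntegral.integral_of_le zero_le_one]
  simpa only [one_mul] using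
    sq_integral_mul_le (μ := volume.restrict (Set.Ioc (0 : ℝ) 1)) (ρ := fun _ => 1)
      (fun _ => zero_le_one) (by simp)
      (by simpa only [one_mul, IntegrableOn] using (hcont.intervalIntegrable 0 1).1)
      (by simpa only [one_mul, IntegrableOn] using (hcont₂.intervalIntegrable 0 1).1)

variable [MeasurableSpace E] [BorelSpace E] [FiniteDimensional ℝ E] {μ : Measure E}
  [μ.IsAddHaarMeasure]

theorem lintegral_sq_sub_translate_le (hf : ContDiff ℝ 1 f) (y : E) :
    ∫⁻ x, ENNReal.ofReal ((f (x - y) - f x) ^ 2) ∂μ ≤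
      ∫⁻ x, ENNReal.ofReal (fderiv ℝ f x y ^ 2) ∂μ := by
  have := hf.continuous_fderiv one_ne_zero
  calc ∫⁻ x, ENNReal.ofReal ((f (x - y) - f x) ^ 2) ∂μ
      ≤ ∫⁻ x, (∫⁻ t in Set.Ioc (0 : ℝ) 1, ENNReal.ofReal (fderiv ℝ f (x - t • y) y ^ 2)) ∂μ := by
        refine lintegral_mono fun x => ?_
        have hcont : Continuous fun t : ℝ => fderiv ℝ f (x - t • y) y ^ 2 := by fun_prop
        refine (ENNReal.ofReal_le_ofReal (sq_sub_translate_le hf x y)).trans_eq ?_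
        rw [intervalIntegral.integral_of_le zero_le_one, ofReal_integral_eq_lintegral_ofReal
          (hcont.intervalIntegrable 0 1).1 (.of_forall fun t => sq_nonneg _)]
    _ = ∫⁻ t in Set.Ioc (0 : ℝ) 1, ∫⁻ x, ENNReal.ofReal (fderiv ℝ f (x - t • y) y ^ 2) ∂μ :=
        lintegral_lintegral_swap <| by
          simp only [Function.uncurry_def]
          fun_prop
    _ = ∫⁻ _t in Set.Ioc (0 : ℝ) 1, ∫⁻ x, ENNReal.ofReal (fderiv ℝ f x y ^ 2) ∂μ :=
        lintegral_congr fun t =>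
          lintegral_sub_right_eq_self (fun x => ENNReal.ofReal (fderiv ℝ f x y ^ 2)) (t • y)
    _ = ∫⁻ x, ENNReal.ofReal (fderiv ℝ f x y ^ 2) ∂μ := by simp

end NormedSpace

section Mollify

variable {E : Type*} [NormedAddCommGroup E] [MeasurableSpace E] [BorelSpace E] {μ : Measure E}
  [IsFiniteMeasureOnCompacts μ] {f ρ : E → ℝ}

theorem sq_mollify_sub_le (hρc : Continuous ρ) (hρs : HasCompactSupport ρ)
    (hρ₀ : ∀ y, 0 ≤ ρ y) (hρ₁ : ∫ y, ρ y ∂μ = 1) (hf : Continuous f) (x : E) :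
    ((∫ y, ρ y * f (x - y) ∂μ) - f x) ^ 2 ≤ ∫ y, ρ y * (f (x - y) - f x) ^ 2 ∂μ := by
  have hint (g : E → ℝ) (hg : Continuous g) : Integrable (fun y => ρ y * g y) μ :=
    (hρc.mul hg).integrable_of_hasCompactSupport hρs.mul_right
  have hsub : (∫ y, ρ y * f (x - y) ∂μ) - f x = ∫ y, ρ y * (f (x - y) - f x) ∂μ := by
    simp only [mul_sub]
    rw [integral_sub (hint _ (by fun_prop)) (hint _ (by fun_prop)), integral_mul_const, hρ₁,
      one_mul]
  rw [hsub]
  exact sq_integral_mul_le hρ₀ hρ₁ (hint _ (by fun_prop)) (hint _ (by fun_prop))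

theorem lintegral_sq_mollify_sub_le [SecondCountableTopology E] [SFinite μ] (hρc : Continuous ρ)
    (hρs : HasCompactSupport ρ) (hρ₀ : ∀ y, 0 ≤ ρ y) (hρ₁ : ∫ y, ρ y ∂μ = 1)
    (hf : Continuous f) {C : ENNReal}
    (hC : ∀ y, ρ y ≠ 0 → ∫⁻ x, ENNReal.ofReal ((f (x - y) - f x) ^ 2) ∂μ ≤ C) :
    ∫⁻ x, ENNReal.ofReal (((∫ y, ρ y * f (x - y) ∂μ) - f x) ^ 2) ∂μ ≤ C := by
  have hρi : Integrable ρ μ := hρc.integrable_of_hasCompactSupport hρs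
  calc ∫⁻ x, ENNReal.ofReal (((∫ y, ρ y * f (x - y) ∂μ) - f x) ^ 2) ∂μ
      ≤ ∫⁻ x, ∫⁻ y, ENNReal.ofReal (ρ y) * ENNReal.ofReal ((f (x - y) - f x) ^ 2) ∂μ ∂μ := by
        refine lintegral_mono fun x => ?_
        refine (ENNReal.ofReal_le_ofReal (sq_mollify_sub_le hρc hρs hρ₀ hρ₁ hf x)).trans_eq ?_
        rw [ofReal_integral_eq_lintegral_ofReal
          (((by fun_prop : Continuous fun y => ρ y * (f (x - y) - f x) ^ 2)
            ).integrable_of_hasCompactSupport hρs.mul_right)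
          (.of_forall fun y => mul_nonneg (hρ₀ y) (sq_nonneg _))]
        exact lintegral_congr fun y => ENNReal.ofReal_mul (hρ₀ y)
    _ = ∫⁻ y, ENNReal.ofReal (ρ y) * ∫⁻ x, ENNReal.ofReal ((f (x - y) - f x) ^ 2) ∂μ ∂μ := by
        rw [lintegral_lintegral_swap (by simp only [Function.uncurry_def]; fun_prop)]
        exact lintegral_congr fun y => lintegral_const_mul' _ _ ENNReal.ofReal_ne_top
    _ ≤ ∫⁻ y, ENNReal.ofReal (ρ y) * C ∂μ := by
        refine lintegral_mono fun y => ?_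
        rcases eq_or_ne (ρ y) 0 with hy | hy
        · simp [hy]
        · exact mul_le_mul_right (hC y hy) _
    _ = C := by
        rw [lintegral_mul_const _ (by fun_prop),
          ← ofReal_integral_eq_lintegral_ofReal hρi (.of_forall hρ₀), hρ₁, ENNReal.ofReal_one,
          one_mul]

end Mollify

end Translation

section Rellich

section TestFunction

variable {N : ℕ} {Ω : Opens (Space N)}

theorem inner_testToL2 (u : L2 Ω ℝ) (ψ : 𝓓(Ω, ℝ)) :
    inner ℝ u (testToL2 Ω ℝ ψ) = ∫ x in (Ω : Set (Space N)), u x * ψ x := by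
  rw [L2.inner_def]
  refine integral_congr_ae ?_
  filter_upwards [coeFn_testToL2 ψ] with x hx
  rw [hx]
  exact mul_comm _ _

theorem setIntegral_mul_testFunction (f : Space N → ℝ) (ψ : 𝓓(Ω, ℝ)) :
    ∫ x in (Ω : Set (Space N)), f x * ψ x = ∫ x, f x * ψ x :=
  setIntegral_eq_integral_of_forall_compl_eq_zero fun x hx => by
    rw [testFunction_eq_zero ψ hx, mul_zero]

theorem norm_sq_testToL2 (ψ : 𝓓(Ω, ℝ)) : ‖testToL2 Ω ℝ ψ‖ ^ 2 = ∫ x, ψ x ^ 2 := by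
  simp only [sq (ψ _), ← setIntegral_mul_testFunction, ← real_inner_self_eq_norm_sq,
    inner_testToL2]
  refine integral_congr_ae ?_
  filter_upwards [coeFn_testToL2 ψ] with x hx
  rw [hx]

theorem integrable_testFunction_sq (ψ : 𝓓(Ω, ℝ)) : Integrable fun x => ψ x ^ 2 :=
  Continuous.integrable_of_hasCompactSupport (ψ.continuous.pow 2)
    (HasCompactSupport.comp_left (g := fun t : ℝ => t ^ 2) ψ.hasCompactSupport (by simp))

theorem ofReal_norm_sq_testToL2 (ψ : 𝓓(Ω, ℝ)) :
    ENNReal.ofReal (‖testToL2 Ω ℝ ψ‖ ^ 2) = ∫⁻ x, ENNReal.ofReal (ψ x ^ 2) := by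
  rw [norm_sq_testToL2, ofReal_integral_eq_lintegral_ofReal (integrable_testFunction_sq ψ)
    (.of_forall fun x => sq_nonneg _)]

theorem sum_smul_basisVec (y : Space N) : ∑ j, y j • basisVec j = y := by
  simpa [basisVec] using (EuclideanSpace.basisFun (Fin N) ℝ).sum_repr y

theorem fderiv_testFunction_apply (ψ : 𝓓(Ω, ℝ)) (x y : Space N) :
    fderiv ℝ ψ x y = ∑ j, y j * partialDeriv j ψ x := by
  conv_lhs => rw [← sum_smul_basisVec y]
  simp only [map_sum, map_smul, smul_eq_mul, partialDeriv_apply]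

theorem sq_fderiv_testFunction_apply_le (ψ : 𝓓(Ω, ℝ)) (x y : Space N) :
    fderiv ℝ ψ x y ^ 2 ≤ ‖y‖ ^ 2 * ∑ j, partialDeriv j ψ x ^ 2 := by
  rw [fderiv_testFunction_apply, EuclideanSpace.real_norm_sq_eq]
  exact Finset.sum_mul_sq_le_sq_mul_sq _ _ _

theorem lintegral_sum_partialDeriv_sq (ψ : 𝓓(Ω, ℝ)) :
    ∫⁻ x, ENNReal.ofReal (∑ j, partialDeriv j ψ x ^ 2) =
      ENNReal.ofReal (energy (testWithGradient Ω ℝ ψ)) := by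
  simp only [energy, ENNReal.ofReal_sum_of_nonneg fun _ _ => sq_nonneg _, testWithGradient_snd,
    ofReal_norm_sq_testToL2]
  refine lintegral_finsetSum _ fun j _ => ?_
  have := (partialDeriv j ψ).continuous
  fun_prop

theorem lintegral_sq_testFunction_sub_translate_le (ψ : 𝓓(Ω, ℝ)) (y : Space N) :
    ∫⁻ x, ENNReal.ofReal ((ψ (x - y) - ψ x) ^ 2) ≤
      ENNReal.ofReal (‖y‖ ^ 2 * energy (testWithGradient Ω ℝ ψ)) := by
  refine (lintegral_sq_sub_translate_le (ψ.contDiff.of_le (by simp)) y).trans ?_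
  rw [ENNReal.ofReal_mul (sq_nonneg _), ← lintegral_sum_partialDeriv_sq,
    ← lintegral_const_mul' _ _ ENNReal.ofReal_ne_top]
  refine lintegral_mono fun x => ?_
  rw [← ENNReal.ofReal_mul (sq_nonneg _)]
  exact ENNReal.ofReal_le_ofReal (sq_fderiv_testFunction_apply_le ψ x y)

theorem lintegral_sq_mollify_testFunction_sub_le (ψ : 𝓓(Ω, ℝ)) {ρ : Space N → ℝ}
    (hρc : Continuous ρ) (hρs : HasCompactSupport ρ) (hρ₀ : ∀ y, 0 ≤ ρ y) (hρ₁ : ∫ y, ρ y = 1)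
    {δ : ℝ} (hδ : ∀ y, ρ y ≠ 0 → ‖y‖ ≤ δ) :
    ∫⁻ x, ENNReal.ofReal (((∫ y, ρ y * ψ (x - y)) - ψ x) ^ 2) ≤
      ENNReal.ofReal (δ ^ 2 * energy (testWithGradient Ω ℝ ψ)) := by
  refine lintegral_sq_mollify_sub_le hρc hρs hρ₀ hρ₁ ψ.continuous fun y hy =>
    (lintegral_sq_testFunction_sub_translate_le ψ y).trans (ENNReal.ofReal_le_ofReal ?_)
  gcongr
  · exact energy_nonneg _
  · exact hδ y hy

end TestFunction

theorem continuous_compContinuous_sub {E : Type*} [SeminormedAddCommGroup E]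
    {g : BoundedContinuousFunction E ℝ} (hg : UniformContinuous g) :
    Continuous fun x : E => g.compContinuous ⟨fun z => x - z, by fun_prop⟩ := by
  refine Metric.continuous_iff.2 fun x ε hε => ?_
  obtain ⟨δ, hδ, hgδ⟩ := Metric.uniformContinuous_iff.1 hg (ε / 2) (half_pos hε)
  refine ⟨δ, hδ, fun y hy => lt_of_le_of_lt ?_ (half_lt_self hε)⟩
  refine (BoundedContinuousFunction.dist_le (half_pos hε).le).2 fun z => (hgδ ?_).le
  simpa using hy

variable {N : ℕ} {Ω : Opens (Space N)}

/-- The reflected translate `z ↦ g (x - z)`, as an element of `L²(Ω)`. Pairing with it evaluates the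
convolution with `g` at `x`. -/
noncomputable def translateToL2 [IsFiniteMeasure (volume.restrict (Ω : Set (Space N)))]
    (g : BoundedContinuousFunction (Space N) ℝ) (x : Space N) : L2 Ω ℝ :=
  BoundedContinuousFunction.toLp 2 _ ℝ (g.compContinuous ⟨fun z => x - z, by fun_prop⟩)

section Mollify

variable [IsFiniteMeasure (volume.restrict (Ω : Set (Space N)))]
  {g : BoundedContinuousFunction (Space N) ℝ}

theorem inner_translateToL2_testToL2 (x : Space N) (ψ : 𝓓(Ω, ℝ)) :
    inner ℝ (translateToL2 g x) (testToL2 Ω ℝ ψ) = ∫ y, g y * ψ (x - y) := by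
  rw [inner_testToL2, ← integral_sub_left_eq_self _ volume x]
  simp only [sub_sub_cancel]
  rw [← setIntegral_mul_testFunction]
  refine integral_congr_ae ?_
  filter_upwards [BoundedContinuousFunction.coeFn_toLp (p := 2)
    (volume.restrict (Ω : Set (Space N))) ℝ
      (g.compContinuous ⟨fun z => x - z, by fun_prop⟩)] with z hz
  rw [translateToL2, hz]
  rfl

theorem memLp_innerSL_translateToL2 (hg : UniformContinuous g) :
    MemLp (fun x => innerSL ℝ (translateToL2 (Ω := Ω) g x)) 2
      (volume.restrict (Ω : Set (Space N))) := by
  have hcont : Continuous fun x => innerSL ℝ (translateToL2 (Ω := Ω) g x) :=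
    (innerSL ℝ).continuous.comp
      ((BoundedContinuousFunction.toLp 2 _ ℝ).continuous.comp (continuous_compContinuous_sub hg))
  refine .of_bound hcont.aestronglyMeasurable
    (‖BoundedContinuousFunction.toLp (E := ℝ) 2 (volume.restrict (Ω : Set (Space N))) ℝ‖ * ‖g‖)
    (.of_forall fun x => ?_)
  rw [innerSL_apply_norm]
  refine (ContinuousLinearMap.le_opNorm _ _).trans ?_
  gcongr
  exact (BoundedContinuousFunction.norm_le (norm_nonneg g)).2 fun z => g.norm_coe_le_norm _

theorem norm_sq_kernelOperator_translateToL2_sub_le (hg : UniformContinuous g)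
    (hgs : HasCompactSupport g) (hg₀ : ∀ y, 0 ≤ g y) (hg₁ : ∫ y, g y = 1) {δ : ℝ}
    (hδ : ∀ y, g y ≠ 0 → ‖y‖ ≤ δ) {p : L2 Ω ℝ × (Fin N → L2 Ω ℝ)} (hp : p ∈ H10 Ω ℝ) :
    ‖kernelOperator (memLp_innerSL_translateToL2 hg).toLp p.1 - p.1‖ ^ 2 ≤ δ ^ 2 * energy p := by
  set T := kernelOperator (memLp_innerSL_translateToL2 (Ω := Ω) hg).toLp
  have hclosed : IsClosed {q : L2 Ω ℝ × (Fin N → L2 Ω ℝ) |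
      ‖T q.1 - q.1‖ ^ 2 ≤ δ ^ 2 * energy q} :=
    isClosed_le (((T.continuous.comp continuous_fst).sub continuous_fst).norm.pow 2)
      (continuous_energy.const_mul _)
  refine H10_induction hclosed (fun ψ => ?_) hp
  have hbound : 0 ≤ δ ^ 2 * energy (testWithGradient Ω ℝ ψ) := by
    have := energy_nonneg (testWithGradient Ω ℝ ψ)
    positivity
  refine (ENNReal.ofReal_le_ofReal_iff hbound).1 ?_
  refine le_trans ?_ ((setLIntegral_le_lintegral Ω _).trans
    (lintegral_sq_mollify_testFunction_sub_le ψ g.continuous hgs hg₀ hg₁ hδ))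
  rw [← real_inner_self_eq_norm_sq, L2.inner_def, ofReal_integral_eq_lintegral_ofReal
    (L2.integrable_inner _ _) (.of_forall fun x => real_inner_self_nonneg)]
  refine (lintegral_congr_ae ?_).le
  filter_upwards [Lp.coeFn_sub (T (testToL2 Ω ℝ ψ)) (testToL2 Ω ℝ ψ), coeFn_testToL2 ψ,
    coeFn_kernelOperator (memLp_innerSL_translateToL2 hg).toLp (testToL2 Ω ℝ ψ),
    (memLp_innerSL_translateToL2 (Ω := Ω) hg).coeFn_toLp] with x hsub hψ hT hk
  rw [testWithGradient_fst, hsub, Pi.sub_apply, hT, hk, hψ, innerSL_apply_apply,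
    inner_translateToL2_testToL2, real_inner_self_eq_norm_sq, Real.norm_eq_abs, sq_abs]

end Mollify

theorem exists_isCompactOperator_norm_sub_sq_le
    (hbdd : Bornology.IsBounded (Ω : Set (Space N))) {δ : ℝ} (hδ : 0 < δ) :
    ∃ T : L2 Ω ℝ →L[ℝ] L2 Ω ℝ, IsCompactOperator T ∧
      ∀ p ∈ H10 Ω ℝ, ‖T p.1 - p.1‖ ^ 2 ≤ δ ^ 2 * energy p := by
  have : IsFiniteMeasure (volume.restrict (Ω : Set (Space N))) :=
    ⟨by simpa using hbdd.measure_lt_top⟩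
  let b : ContDiffBump (0 : Space N) := ⟨δ / 2, δ, by positivity, by linarith⟩
  have hc : Continuous (b.normed volume) := b.continuous_normed
  obtain ⟨C, hC⟩ := hc.bounded_above_of_compact_support b.hasCompactSupport_normed
  let g : BoundedContinuousFunction (Space N) ℝ := .ofNormedAddCommGroup (b.normed volume) hc C hC
  have hg : UniformContinuous g :=
    hc.uniformContinuous_of_tendsto_cocompact b.hasCompactSupport_normed.is_zero_at_infty
  refine ⟨_, isCompactOperator_kernelOperator (by simp) (memLp_innerSL_translateToL2 hg).toLp,
    fun p hp => norm_sq_kernelOperator_translateToL2_sub_le hg b.hasCompactSupport_normed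
      b.nonneg_normed b.integral_normed (fun y hy => ?_) hp⟩
  have hmem : y ∈ Function.support (b.normed volume) := hy
  rw [b.support_normed_eq, mem_ball_zero_iff] at hmem
  exact hmem.le

theorem energy_le_mul_norm_sq (p : L2 Ω ℝ × (Fin N → L2 Ω ℝ)) : energy p ≤ N * ‖p‖ ^ 2 := by
  refine (Finset.sum_le_card_nsmul _ _ (‖p‖ ^ 2) fun j _ => ?_).trans_eq (by simp)
  gcongr
  exact (norm_le_pi_norm _ _).trans (norm_snd_le p)

/-- The embedding `H¹₀(Ω) → L²(Ω)`, which forgets the weak gradient. -/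
noncomputable def embedding (Ω : Opens (Space N)) : H10 Ω ℝ →L[ℝ] L2 Ω ℝ :=
  (ContinuousLinearMap.fst ℝ _ _).comp (H10 Ω ℝ).subtypeL

theorem norm_sub_embedding_le {T : L2 Ω ℝ →L[ℝ] L2 Ω ℝ} {δ : ℝ} (hδ : 0 ≤ δ)
    (hT : ∀ p ∈ H10 Ω ℝ, ‖T p.1 - p.1‖ ^ 2 ≤ δ ^ 2 * energy p) (p : H10 Ω ℝ) :
    ‖(T ∘ embedding Ω) p - embedding Ω p‖ ≤ δ * (N + 1) * ‖p‖ := by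
  refine le_of_sq_le_sq ?_ (by positivity)
  calc ‖(T ∘ embedding Ω) p - embedding Ω p‖ ^ 2
    _ ≤ δ ^ 2 * energy p.1 := hT p p.2
    _ ≤ δ ^ 2 * (N * ‖p‖ ^ 2) := by
      gcongr
      exact energy_le_mul_norm_sq _
    _ ≤ δ ^ 2 * ((N + 1) ^ 2 * ‖p‖ ^ 2) := by
      gcongr
      nlinarith
    _ = (δ * (N + 1) * ‖p‖) ^ 2 := by ring

theorem isCompactOperator_embedding (hbdd : Bornology.IsBounded (Ω : Set (Space N))) :
    IsCompactOperator (embedding Ω) := by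
  have happrox (ε : ℝ) (hε : 0 < ε) : ∃ T : H10 Ω ℝ →L[ℝ] L2 Ω ℝ,
      IsCompactOperator T ∧ ∀ p, ‖T p - embedding Ω p‖ ≤ ε * ‖p‖ := by
    obtain ⟨T, hT, hTδ⟩ := exists_isCompactOperator_norm_sub_sq_le hbdd
      (δ := ε / (N + 1)) (by positivity)
    refine ⟨T ∘L embedding Ω, hT.comp_clm _, fun p => ?_⟩
    refine (norm_sub_embedding_le (by positivity) hTδ p).trans_eq ?_
    rw [div_mul_cancel₀ _ (by positivity)]
  exact isCompactOperator_of_forall_norm_sub_le happrox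

end Rellich

section SmoothAbs

/-- The smooth approximation of `|t|` which vanishes at `0`. -/
noncomputable def smoothAbs (δ t : ℝ) : ℝ := √(t ^ 2 + δ ^ 2) - δ

variable {δ : ℝ}

theorem smoothAbs_zero (hδ : 0 ≤ δ) : smoothAbs δ 0 = 0 := by
  simp [smoothAbs, Real.sqrt_sq hδ]

theorem smoothAbs_nonneg (δ t : ℝ) : 0 ≤ smoothAbs δ t :=
  sub_nonneg.2 (Real.le_sqrt_of_sq_le (by nlinarith [sq_nonneg t]))

theorem smoothAbs_le_abs (hδ : 0 ≤ δ) (t : ℝ) : smoothAbs δ t ≤ |t| := by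
  rw [smoothAbs, sub_le_iff_le_add]
  refine Real.sqrt_le_iff.2 ⟨by positivity, ?_⟩
  nlinarith [sq_abs t, abs_nonneg t]

theorem abs_sub_le_smoothAbs (δ t : ℝ) : |t| - δ ≤ smoothAbs δ t :=
  sub_le_sub_right (Real.abs_le_sqrt (by nlinarith)) δ

theorem contDiff_smoothAbs (hδ : δ ≠ 0) {n : ℕ∞ω} : ContDiff ℝ n (smoothAbs δ) :=
  (((contDiff_id.pow 2).add contDiff_const).sqrt fun t => by positivity).sub contDiff_const

theorem abs_deriv_smoothAbs_le_one (hδ : δ ≠ 0) (t : ℝ) : |deriv (smoothAbs δ) t| ≤ 1 := by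
  have hpos : 0 < t ^ 2 + δ ^ 2 := by positivity
  have hderiv := ((((hasDerivAt_pow 2 t).add_const (δ ^ 2)).sqrt hpos.ne').sub_const δ).deriv
  have hsqrt := Real.sqrt_pos.2 hpos
  change |deriv (fun t => √(t ^ 2 + δ ^ 2) - δ) t| ≤ 1
  rw [hderiv, Nat.cast_ofNat, Nat.add_one_sub_one, pow_one, mul_div_mul_left _ _ two_ne_zero,
    abs_div, abs_of_pos hsqrt, div_le_one hsqrt]
  exact Real.abs_le_sqrt (by nlinarith)

variable {N : ℕ} {Ω : Opens (Space N)}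

theorem exists_testFunction_eq_comp {f : ℝ → ℝ} (hf : ContDiff ℝ ∞ f) (hf₀ : f 0 = 0)
    (ψ : 𝓓(Ω, ℝ)) : ∃ χ : 𝓓(Ω, ℝ), ∀ x, χ x = f (ψ x) := by
  have hsub : tsupport (f ∘ ψ) ⊆ tsupport ψ := tsupport_comp_subset hf₀ ψ
  exact ⟨⟨f ∘ ψ, hf.comp ψ.contDiff,
    ψ.hasCompactSupport.of_isClosed_subset (isClosed_tsupport _) hsub,
    hsub.trans ψ.tsupport_subset⟩, fun _ => rfl⟩

theorem energy_comp_le {f : ℝ → ℝ} (hf : Differentiable ℝ f) (hf₁ : ∀ t, |deriv f t| ≤ 1)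
    {χ ψ : 𝓓(Ω, ℝ)} (hχ : ∀ x, χ x = f (ψ x)) :
    energy (testWithGradient Ω ℝ χ) ≤ energy (testWithGradient Ω ℝ ψ) := by
  refine Finset.sum_le_sum fun j _ => pow_le_pow_left₀ (norm_nonneg _) ?_ 2
  refine Lp.norm_le_norm_of_ae_le ?_
  filter_upwards [coeFn_testToL2 (partialDeriv j χ), coeFn_testToL2 (partialDeriv j ψ)]
    with x h₁ h₂
  have hχψ : ⇑χ = f ∘ ψ := funext hχ
  rw [testWithGradient_snd, testWithGradient_snd, h₁, h₂, partialDeriv_apply, partialDeriv_apply,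
    hχψ, fderiv_comp x (hf _) (differentiable_testFunction ψ x), ContinuousLinearMap.comp_apply,
    fderiv_eq_smul_deriv, smul_eq_mul, norm_mul]
  exact mul_le_of_le_one_right (norm_nonneg _) (hf₁ _)

theorem norm_testToL2_sub_le [IsFiniteMeasure (volume.restrict (Ω : Set (Space N)))]
    {χ ψ : 𝓓(Ω, ℝ)} (hδ : 0 ≤ δ) (h : ∀ x, |(|ψ x| - χ x)| ≤ δ) :
    ‖testToL2 Ω ℝ ψ‖ - ‖testToL2 Ω ℝ χ‖ ≤
      (measureUnivNNReal (volume.restrict (Ω : Set (Space N))) : ℝ) ^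
        (2 : ENNReal).toReal⁻¹ * δ := by
  rw [← norm_abs_eq_norm (testToL2 Ω ℝ ψ)]
  refine (norm_sub_norm_le _ _).trans (Lp.norm_le_of_ae_bound hδ ?_)
  filter_upwards [coeFn_testToL2 χ, coeFn_testToL2 ψ, Lp.coeFn_abs (testToL2 Ω ℝ ψ),
    Lp.coeFn_sub |testToL2 Ω ℝ ψ| (testToL2 Ω ℝ χ)] with x h₁ h₂ h₃ h₄
  rw [h₄, Pi.sub_apply, h₃, h₁, h₂]
  exact h x

theorem exists_nonneg_testFunction_energy_le (hbdd : Bornology.IsBounded (Ω : Set (Space N)))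
    (ψ : 𝓓(Ω, ℝ)) {ε : ℝ} (hε : 0 < ε) : ∃ χ : 𝓓(Ω, ℝ), (∀ x, 0 ≤ χ x) ∧
      ‖testToL2 Ω ℝ χ‖ ≤ ‖testToL2 Ω ℝ ψ‖ ∧ ‖testToL2 Ω ℝ ψ‖ - ε ≤ ‖testToL2 Ω ℝ χ‖ ∧
      energy (testWithGradient Ω ℝ χ) ≤ energy (testWithGradient Ω ℝ ψ) := by
  have : IsFiniteMeasure (volume.restrict (Ω : Set (Space N))) :=
    ⟨by simpa using hbdd.measure_lt_top⟩
  set c : ℝ := (measureUnivNNReal (volume.restrict (Ω : Set (Space N))) : ℝ) ^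
    (2 : ENNReal).toReal⁻¹
  obtain ⟨δ, hδ, hcδ⟩ : ∃ δ > 0, c * δ ≤ ε := by
    refine ⟨ε / (c + 1), by positivity, ?_⟩
    rw [mul_div_assoc', div_le_iff₀ (by positivity)]
    nlinarith
  obtain ⟨χ, hχ⟩ := exists_testFunction_eq_comp (contDiff_smoothAbs hδ.ne') (smoothAbs_zero hδ.le) ψ
  have hnonneg (x) : 0 ≤ χ x := hχ x ▸ smoothAbs_nonneg δ _
  have hle (x) : χ x ≤ |ψ x| := hχ x ▸ smoothAbs_le_abs hδ.le _
  have hge (x) : |ψ x| - δ ≤ χ x := hχ x ▸ abs_sub_le_smoothAbs δ _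
  refine ⟨χ, hnonneg, Lp.norm_le_norm_of_ae_le ?_, ?_, energy_comp_le
    ((contDiff_smoothAbs hδ.ne').differentiable one_ne_zero) (abs_deriv_smoothAbs_le_one hδ.ne') hχ⟩
  · filter_upwards [coeFn_testToL2 χ, coeFn_testToL2 ψ] with x h₁ h₂
    rw [h₁, h₂, Real.norm_of_nonneg (hnonneg x)]
    exact hle x
  · have := norm_testToL2_sub_le (χ := χ) (ψ := ψ) hδ.le fun x =>
      abs_le.2 ⟨by linarith [hle x], by linarith [hge x]⟩
    linarith

end SmoothAbs

section Minimizer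

open Filter Topology

variable {N : ℕ} {Ω : Opens (Space N)}

/-- The infimum of the Rayleigh quotient, taken over the test functions. -/
noncomputable def rayleighInf (Ω : Opens (Space N)) : ℝ :=
  sInf {e | ∃ ψ : 𝓓(Ω, ℝ), ‖testToL2 Ω ℝ ψ‖ = 1 ∧ energy (testWithGradient Ω ℝ ψ) = e}

theorem rayleighInf_nonneg : 0 ≤ rayleighInf Ω :=
  Real.sInf_nonneg (by rintro _ ⟨ψ, -, rfl⟩; exact energy_nonneg _)

theorem rayleighInf_le_energy {ψ : 𝓓(Ω, ℝ)} (hψ : ‖testToL2 Ω ℝ ψ‖ = 1) :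
    rayleighInf Ω ≤ energy (testWithGradient Ω ℝ ψ) :=
  csInf_le ⟨0, by rintro _ ⟨ψ, -, rfl⟩; exact energy_nonneg _⟩ ⟨ψ, hψ, rfl⟩

theorem norm_testToL2_inv_norm_smul {ψ : 𝓓(Ω, ℝ)} (hψ : ‖testToL2 Ω ℝ ψ‖ ≠ 0) :
    ‖testToL2 Ω ℝ (‖testToL2 Ω ℝ ψ‖⁻¹ • ψ)‖ = 1 := by
  rw [map_smul, norm_smul, norm_inv, norm_norm, inv_mul_cancel₀ hψ]

theorem rayleighInf_mul_norm_sq_le {p : L2 Ω ℝ × (Fin N → L2 Ω ℝ)} (hp : p ∈ H10 Ω ℝ) :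
    rayleighInf Ω * ‖p.1‖ ^ 2 ≤ energy p := by
  refine H10_induction (isClosed_le ((continuous_fst.norm.pow 2).const_mul _) continuous_energy)
    (fun ψ => ?_) hp
  change rayleighInf Ω * ‖testToL2 Ω ℝ ψ‖ ^ 2 ≤ energy (testWithGradient Ω ℝ ψ)
  rcases eq_or_ne ‖testToL2 Ω ℝ ψ‖ 0 with hzero | hne
  · simpa [hzero] using energy_nonneg _
  · have h := rayleighInf_le_energy (norm_testToL2_inv_norm_smul hne)
    rw [map_smul, energy_smul, inv_pow, inv_mul_eq_div] at h
    exact (le_div_iff₀ (by positivity)).1 h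

theorem exists_testFunction_norm_eq_one (hne : (Ω : Set (Space N)).Nonempty) :
    ∃ ψ : 𝓓(Ω, ℝ), ‖testToL2 Ω ℝ ψ‖ = 1 := by
  obtain ⟨x, hx⟩ := hne
  obtain ⟨r, hr, hball⟩ := Metric.nhds_basis_closedBall.mem_iff.1 (Ω.isOpen.mem_nhds hx)
  let b : ContDiffBump x := ⟨r / 2, r, by positivity, by linarith⟩
  let ψ : 𝓓(Ω, ℝ) := ⟨b, b.contDiff, b.hasCompactSupport, b.tsupport_eq.trans_subset hball⟩
  have hψ : 0 < ‖testToL2 Ω ℝ ψ‖ ^ 2 := by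
    rw [norm_sq_testToL2]
    refine Continuous.integral_pos_of_hasCompactSupport_nonneg_nonzero (x := x)
      (ψ.continuous.pow 2)
      (HasCompactSupport.comp_left (g := fun t : ℝ => t ^ 2) ψ.hasCompactSupport (by simp))
      (fun _ => sq_nonneg _) (pow_ne_zero 2 (b.pos_of_mem_ball (Metric.mem_ball_self hr)).ne')
  exact ⟨_, norm_testToL2_inv_norm_smul (pow_ne_zero_iff two_ne_zero |>.1 hψ.ne')⟩

theorem exists_nonneg_testFunction_energy_le_rayleighInf_add
    (hbdd : Bornology.IsBounded (Ω : Set (Space N))) (hne : (Ω : Set (Space N)).Nonempty)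
    {ε : ℝ} (hε : 0 < ε) : ∃ χ : 𝓓(Ω, ℝ), (∀ x, 0 ≤ χ x) ∧ ‖testToL2 Ω ℝ χ‖ ≤ 1 ∧
      1 - ε ≤ ‖testToL2 Ω ℝ χ‖ ∧ energy (testWithGradient Ω ℝ χ) ≤ rayleighInf Ω + ε := by
  obtain ⟨ψ₀, hψ₀⟩ := exists_testFunction_norm_eq_one hne
  obtain ⟨_, ⟨ψ, hψ, rfl⟩, hlt⟩ := exists_lt_of_csInf_lt
    (s := {e | ∃ ψ : 𝓓(Ω, ℝ), ‖testToL2 Ω ℝ ψ‖ = 1 ∧ energy (testWithGradient Ω ℝ ψ) = e})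
    ⟨_, ψ₀, hψ₀, rfl⟩ (lt_add_of_pos_right (rayleighInf Ω) hε)
  obtain ⟨χ, hnonneg, hle, hge, henergy⟩ := exists_nonneg_testFunction_energy_le hbdd ψ hε
  rw [hψ] at hle hge
  exact ⟨χ, hnonneg, hle, hge, henergy.trans hlt.le⟩

theorem exists_minimizing_sequence (hbdd : Bornology.IsBounded (Ω : Set (Space N)))
    (hne : (Ω : Set (Space N)).Nonempty) : ∃ χ : ℕ → 𝓓(Ω, ℝ), (∀ n x, 0 ≤ χ n x) ∧
      Tendsto (fun n => ‖testToL2 Ω ℝ (χ n)‖) atTop (𝓝 1) ∧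
      Tendsto (fun n => energy (testWithGradient Ω ℝ (χ n))) atTop (𝓝 (rayleighInf Ω)) := by
  choose χ hnonneg hle hge henergy using fun n : ℕ =>
    exists_nonneg_testFunction_energy_le_rayleighInf_add hbdd hne (Nat.one_div_pos_of_nat (n := n))
  have hzero : Tendsto (fun n : ℕ => 1 / ((n : ℝ) + 1)) atTop (𝓝 0) :=
    tendsto_one_div_add_atTop_nhds_zero_nat
  have hnorm : Tendsto (fun n => ‖testToL2 Ω ℝ (χ n)‖) atTop (𝓝 1) :=
    tendsto_of_tendsto_of_tendsto_of_le_of_le (by simpa using hzero.const_sub 1)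
      tendsto_const_nhds hge hle
  refine ⟨χ, hnonneg, hnorm, tendsto_of_tendsto_of_tendsto_of_le_of_le
    (by simpa [testWithGradient_fst] using (hnorm.pow 2).const_mul (rayleighInf Ω))
    (by simpa using hzero.const_add (rayleighInf Ω))
    (fun n => rayleighInf_mul_norm_sq_le (testWithGradient_mem_H10 Ω ℝ (χ n))) henergy⟩

theorem norm_le_norm_fst_add_sqrt_energy (p : L2 Ω ℝ × (Fin N → L2 Ω ℝ)) :
    ‖p‖ ≤ ‖p.1‖ + √(energy p) := by
  refine max_le (by simp) ((pi_norm_le_iff_of_nonneg (by positivity)).2 fun j => ?_)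
  exact (Real.le_sqrt_of_sq_le (norm_sq_le_energy p j)).trans (by simp)

theorem exists_subseq_tendsto_fst (hbdd : Bornology.IsBounded (Ω : Set (Space N)))
    {q : ℕ → L2 Ω ℝ × (Fin N → L2 Ω ℝ)} (hq : ∀ n, q n ∈ H10 Ω ℝ) {C : ℝ}
    (hC : ∀ n, ‖q n‖ ≤ C) :
    ∃ u, ∃ f : ℕ → ℕ, StrictMono f ∧ Tendsto (fun n => (q (f n)).1) atTop (𝓝 u) := by
  obtain ⟨K, hK, hsub⟩ :=
    (isCompactOperator_embedding hbdd).image_closedBall_subset_compact C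
  obtain ⟨u, -, f, hf, hlim⟩ := hK.tendsto_subseq (x := fun n => (q n).1) fun n =>
    hsub ⟨⟨q n, hq n⟩, mem_closedBall_zero_iff.2 (hC n), rfl⟩
  exact ⟨u, f, hf, hlim⟩

theorem energy_sub_le {p q : L2 Ω ℝ × (Fin N → L2 Ω ℝ)} (hp : p ∈ H10 Ω ℝ) (hq : q ∈ H10 Ω ℝ) :
    energy (p - q) ≤ 2 * (energy p + energy q) - rayleighInf Ω * ‖p.1 + q.1‖ ^ 2 := by
  have hadd := rayleighInf_mul_norm_sq_le ((H10 Ω ℝ).add_mem hp hq)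
  rw [Prod.fst_add] at hadd
  linarith [energy_sub_add_energy_add p q]

theorem cauchySeq_snd_of_tendsto_energy {q : ℕ → L2 Ω ℝ × (Fin N → L2 Ω ℝ)}
    (hq : ∀ n, q n ∈ H10 Ω ℝ) {u : L2 Ω ℝ} (hu : Tendsto (fun n => (q n).1) atTop (𝓝 u))
    (hE : Tendsto (fun n => energy (q n)) atTop (𝓝 (rayleighInf Ω * ‖u‖ ^ 2))) (j : Fin N) :
    CauchySeq fun n => (q n).2 j := by
  have hfst : Tendsto (Prod.fst : ℕ × ℕ → ℕ) atTop atTop := by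
    rw [← prod_atTop_atTop_eq]; exact tendsto_fst
  have hsnd : Tendsto (Prod.snd : ℕ × ℕ → ℕ) atTop atTop := by
    rw [← prod_atTop_atTop_eq]; exact tendsto_snd
  have hdefect : Tendsto (fun n : ℕ × ℕ => 2 * (energy (q n.1) + energy (q n.2)) -
      rayleighInf Ω * ‖(q n.1).1 + (q n.2).1‖ ^ 2) atTop (𝓝 0) := by
    have h := (((hE.comp hfst).add (hE.comp hsnd)).const_mul 2).sub
      ((((hu.comp hfst).add (hu.comp hsnd)).norm.pow 2).const_mul (rayleighInf Ω))
    have hlimit : 2 * (rayleighInf Ω * ‖u‖ ^ 2 + rayleighInf Ω * ‖u‖ ^ 2) -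
        rayleighInf Ω * ‖u + u‖ ^ 2 = 0 := by
      rw [← two_smul ℝ u, norm_smul, Real.norm_two]
      ring
    rwa [hlimit] at h
  rw [cauchySeq_iff_tendsto_dist_atTop_0]
  refine squeeze_zero (fun _ => dist_nonneg) (fun n => Real.le_sqrt_of_sq_le ?_)
    (by simpa using hdefect.sqrt)
  rw [dist_eq_norm]
  exact (norm_sq_le_energy (q n.1 - q n.2) j).trans (energy_sub_le (hq n.1) (hq n.2))

theorem exists_subseq_tendsto_of_minimizing (hbdd : Bornology.IsBounded (Ω : Set (Space N)))
    {q : ℕ → L2 Ω ℝ × (Fin N → L2 Ω ℝ)} (hq : ∀ n, q n ∈ H10 Ω ℝ)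
    (hnorm : Tendsto (fun n => ‖(q n).1‖) atTop (𝓝 1))
    (hE : Tendsto (fun n => energy (q n)) atTop (𝓝 (rayleighInf Ω))) :
    ∃ p, ∃ f : ℕ → ℕ, StrictMono f ∧ Tendsto (q ∘ f) atTop (𝓝 p) := by
  obtain ⟨C, hC⟩ := (hnorm.add hE.sqrt).bddAbove_range
  obtain ⟨u, f, hf, hu⟩ := exists_subseq_tendsto_fst hbdd hq fun n =>
    (norm_le_norm_fst_add_sqrt_energy (q n)).trans (hC ⟨n, rfl⟩)
  have hu₁ : ‖u‖ = 1 := tendsto_nhds_unique hu.norm (hnorm.comp hf.tendsto_atTop)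
  choose g hg using fun j => cauchySeq_tendsto_of_complete <|
    cauchySeq_snd_of_tendsto_energy (fun n => hq (f n)) hu
      (by simpa [hu₁, Function.comp_def] using hE.comp hf.tendsto_atTop) j
  exact ⟨(u, g), f, hf, hu.prodMk_nhds (tendsto_pi_nhds.2 hg)⟩

theorem exists_nonneg_minimizer (hbdd : Bornology.IsBounded (Ω : Set (Space N)))
    (hne : (Ω : Set (Space N)).Nonempty) :
    ∃ p ∈ H10 Ω ℝ, 0 ≤ p.1 ∧ ‖p.1‖ = 1 ∧ energy p = rayleighInf Ω := by
  obtain ⟨χ, hnonneg, hnorm, hE⟩ := exists_minimizing_sequence hbdd hne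
  have hmem (n) := testWithGradient_mem_H10 Ω ℝ (χ n)
  have hχ (n) : 0 ≤ testToL2 Ω ℝ (χ n) := (Lp.coeFn_nonneg _).1 <|
    (coeFn_testToL2 (χ n)).mono fun x hx => hx ▸ hnonneg n x
  obtain ⟨p, f, hf, hp⟩ := exists_subseq_tendsto_of_minimizing hbdd hmem hnorm hE
  have hp₁ := (continuous_fst.tendsto p).comp hp
  exact ⟨p, isClosed_H10.mem_of_tendsto hp (.of_forall fun n => hmem _),
    ge_of_tendsto hp₁ (.of_forall fun n => hχ _),
    tendsto_nhds_unique hp₁.norm (hnorm.comp hf.tendsto_atTop),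
    tendsto_nhds_unique ((continuous_energy.tendsto p).comp hp) (hE.comp hf.tendsto_atTop)⟩

theorem sum_inner_eq_of_energy_eq_rayleighInf {p : L2 Ω ℝ × (Fin N → L2 Ω ℝ)}
    (hp : p ∈ H10 Ω ℝ) (hE : energy p = rayleighInf Ω * ‖p.1‖ ^ 2)
    {q : L2 Ω ℝ × (Fin N → L2 Ω ℝ)} (hq : q ∈ H10 Ω ℝ) :
    ∑ j, inner ℝ (p.2 j) (q.2 j) = inner ℝ (rayleighInf Ω • p.1) q.1 := by
  set l := rayleighInf Ω
  -- `p` minimizes `energy - l ‖·‖²`, so this quadratic polynomial in `t` has a root at its minimum.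
  have hquad (t : ℝ) : 0 ≤ (energy q - l * ‖q.1‖ ^ 2) * (t * t) +
      2 * (∑ j, inner ℝ (p.2 j) (q.2 j) - l * inner ℝ p.1 q.1) * t + 0 := by
    have h := rayleighInf_mul_norm_sq_le ((H10 Ω ℝ).add_mem hp ((H10 Ω ℝ).smul_mem t hq))
    rw [energy_add, energy_smul, hE, Prod.fst_add, Prod.smul_fst, norm_add_sq_real,
      real_inner_smul_right, norm_smul, mul_pow, Real.norm_eq_abs, sq_abs] at h
    simp only [Prod.smul_snd, Pi.smul_apply, real_inner_smul_right, ← Finset.mul_sum] at h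
    linarith
  have hdiscrim := discrim_le_zero hquad
  rw [discrim, mul_zero, sub_zero] at hdiscrim
  have hlinear := pow_eq_zero_iff two_ne_zero |>.1 (le_antisymm hdiscrim (sq_nonneg _))
  rw [real_inner_smul_left]
  linarith

theorem mem_laplacianGraph_iff {F : Type*} [NormedAddCommGroup F] [InnerProductSpace ℝ F]
    [CompleteSpace F] {u f : L2 Ω F} : (u, f) ∈ laplacianGraph Ω F ↔
      ∃ hu : u ∈ (dirichletLaplacian Ω F).domain, dirichletLaplacian Ω F ⟨u, hu⟩ = f := by
  rw [← dirichletLaplacian_graph, LinearPMap.mem_graph_iff]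
  constructor
  · rintro ⟨y, rfl, h⟩
    exact ⟨y.2, h⟩
  · rintro ⟨hu, h⟩
    exact ⟨⟨u, hu⟩, rfl, h⟩

theorem rayleighInf_le_of_mem_laplacianGraph {l : ℝ} {u : L2 Ω ℝ} (hu : u ≠ 0)
    (h : (u, l • u) ∈ laplacianGraph Ω ℝ) : rayleighInf Ω ≤ l := by
  obtain ⟨g, hg, hweak⟩ := h
  have henergy : energy (u, g) = l * ‖u‖ ^ 2 := by
    simpa only [energy, real_inner_self_eq_norm_sq, real_inner_smul_left] using hweak _ hg
  exact le_of_mul_le_mul_right (henergy ▸ rayleighInf_mul_norm_sq_le hg) (by positivity)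

theorem exists_nonneg_eigenfunction (hbdd : Bornology.IsBounded (Ω : Set (Space N)))
    (hne : (Ω : Set (Space N)).Nonempty) :
    0 ≤ firstEigenvalue Ω ∧ ∃ u : L2 Ω ℝ, 0 ≤ u ∧ u ≠ 0 ∧
      (u, firstEigenvalue Ω • u) ∈ laplacianGraph Ω ℝ := by
  obtain ⟨p, hp, hnonneg, hnorm, hE⟩ := exists_nonneg_minimizer hbdd hne
  have hp₀ : p.1 ≠ 0 := norm_ne_zero_iff.1 (hnorm ▸ one_ne_zero)
  have hgraph : (p.1, rayleighInf Ω • p.1) ∈ laplacianGraph Ω ℝ :=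
    ⟨p.2, hp, fun q hq => sum_inner_eq_of_energy_eq_rayleighInf hp (by simp [hE, hnorm]) hq⟩
  have heq : firstEigenvalue Ω = rayleighInf Ω := by
    obtain ⟨hdom, h⟩ := mem_laplacianGraph_iff.1 hgraph
    refine IsLeast.csInf_eq ⟨⟨⟨p.1, hdom⟩, hp₀, h⟩, ?_⟩
    rintro l ⟨φ, hφ, hl⟩
    exact rayleighInf_le_of_mem_laplacianGraph hφ (mem_laplacianGraph_iff.2 ⟨φ.2, hl⟩)
  exact ⟨heq ▸ rayleighInf_nonneg, p.1, hnonneg, hp₀, heq ▸ hgraph⟩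

end Minimizer

section BumpProfile

theorem deriv_eq_zero_of_forall_ge {f : ℝ → ℝ} (hf : Differentiable ℝ f) {a : ℝ}
    (h : ∀ t, a ≤ t → f t = 0) {t : ℝ} (ht : a ≤ t) : deriv f t = 0 := by
  have hzero : HasDerivWithinAt f 0 (Set.Ici a) t :=
    (hasDerivWithinAt_const t _ (0 : ℝ)).congr h (h t ht)
  exact (uniqueDiffOn_Ici a t ht).eq_deriv _ (hf t).hasDerivAt.hasDerivWithinAt hzero

theorem exists_forall_nonneg_abs_le {f : ℝ → ℝ} (hf : Continuous f) {a : ℝ}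
    (h : ∀ t, a ≤ t → f t = 0) : ∃ C, ∀ t, 0 ≤ t → |f t| ≤ C := by
  obtain ⟨C, hC⟩ := isCompact_Icc.exists_bound_of_continuousOn (s := Set.Icc 0 a) hf.continuousOn
  refine ⟨max C 0, fun t ht => ?_⟩
  rcases le_total a t with hat | hta
  · rw [h t hat, abs_zero]
    exact le_max_right _ _
  · exact (hC t ⟨ht, hta⟩).trans (le_max_left _ _)

/-- A smooth decreasing profile `ℝ → [0, ∞)` supported in `(-∞, 1]`; the functions
`y ↦ bumpProfile (a * ‖y - x‖ ^ 2)` are the radial test functions of the mean value inequality. -/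
noncomputable def bumpProfile (t : ℝ) : ℝ := expNegInvGlue (1 - t)

theorem bumpProfile_nonneg (t : ℝ) : 0 ≤ bumpProfile t := expNegInvGlue.nonneg _

theorem bumpProfile_eq_zero {t : ℝ} (ht : 1 ≤ t) : bumpProfile t = 0 :=
  expNegInvGlue.zero_of_nonpos (sub_nonpos.2 ht)

theorem contDiff_bumpProfile : ContDiff ℝ ∞ bumpProfile :=
  expNegInvGlue.contDiff.comp (contDiff_const.sub contDiff_id)

theorem contDiff_deriv_bumpProfile : ContDiff ℝ ∞ (deriv bumpProfile) :=
  (contDiff_infty_iff_deriv.1 contDiff_bumpProfile).2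

theorem deriv_bumpProfile (t : ℝ) :
    deriv bumpProfile t = -((1 - t)⁻¹ ^ 2 * expNegInvGlue (1 - t)) := by
  have h := expNegInvGlue.hasDerivAt_polynomial_eval_inv_mul 1 (1 - t)
  simp only [Polynomial.eval_one, one_mul, Polynomial.derivative_one, sub_zero, mul_one,
    Polynomial.eval_pow, Polynomial.eval_X] at h
  have hcomp := h.comp t ((hasDerivAt_const t (1 : ℝ)).sub (hasDerivAt_id t))
  rw [zero_sub, mul_neg_one] at hcomp
  exact hcomp.deriv

theorem deriv_bumpProfile_nonpos (t : ℝ) : deriv bumpProfile t ≤ 0 := by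
  rw [deriv_bumpProfile, Left.neg_nonpos_iff]
  exact mul_nonneg (sq_nonneg _) (expNegInvGlue.nonneg _)

theorem deriv_bumpProfile_neg {t : ℝ} (ht : t < 1) : deriv bumpProfile t < 0 := by
  rw [deriv_bumpProfile, Left.neg_neg_iff]
  have := expNegInvGlue.pos_of_pos (sub_pos.2 ht)
  have := sub_pos.2 ht
  positivity

theorem deriv_bumpProfile_eq_zero {t : ℝ} (ht : 1 ≤ t) : deriv bumpProfile t = 0 :=
  deriv_eq_zero_of_forall_ge (contDiff_bumpProfile.differentiable (by simp))
    (fun _ => bumpProfile_eq_zero) ht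

end BumpProfile

section Radial

variable {N : ℕ} {Ω : Opens (Space N)}

theorem hasFDerivAt_comp_mul_norm_sq {E : Type*} [NormedAddCommGroup E] [InnerProductSpace ℝ E]
    {f : ℝ → ℝ} (hf : Differentiable ℝ f) (a : ℝ) (x y : E) :
    HasFDerivAt (fun y => f (a * ‖y - x‖ ^ 2))
      ((2 * a * deriv f (a * ‖y - x‖ ^ 2)) • innerSL ℝ (y - x)) y := by
  have h := (hf (a * ‖y - x‖ ^ 2)).hasDerivAt.comp_hasFDerivAt y
    (((hasFDerivAt_id y).sub_const x).norm_sq.const_mul a)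
  refine h.congr_fderiv ?_
  ext v
  simp only [id_eq, map_sub, ContinuousLinearMap.comp_id, smul_apply, sub_apply,
    coe_innerSL_apply, nsmul_eq_mul, Nat.cast_ofNat, smul_eq_mul]
  ring

theorem innerSL_basisVec (y : Space N) (j : Fin N) : innerSL ℝ y (basisVec j) = y j := by
  simp [basisVec, EuclideanSpace.inner_single_right]

theorem partialDeriv_radial {f : ℝ → ℝ} (hf : Differentiable ℝ f) {a : ℝ} {x : Space N}
    {ψ : 𝓓(Ω, ℝ)} (hψ : ∀ y, ψ y = f (a * ‖y - x‖ ^ 2)) (j : Fin N) (y : Space N) :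
    partialDeriv j ψ y = 2 * a * (deriv f (a * ‖y - x‖ ^ 2) * (y - x) j) := by
  rw [partialDeriv_apply, funext hψ, (hasFDerivAt_comp_mul_norm_sq hf a x y).fderiv,
    smul_apply, innerSL_basisVec, smul_eq_mul, mul_assoc]

theorem sum_partialDeriv_partialDeriv_radial {f : ℝ → ℝ} (hf : ContDiff ℝ ∞ f) {a : ℝ}
    {x : Space N} {ψ : 𝓓(Ω, ℝ)} (hψ : ∀ y, ψ y = f (a * ‖y - x‖ ^ 2)) (y : Space N) :
    ∑ j, partialDeriv j (partialDeriv j ψ) y = 2 * a * (N * deriv f (a * ‖y - x‖ ^ 2) +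
      2 * (a * ‖y - x‖ ^ 2 * deriv (deriv f) (a * ‖y - x‖ ^ 2))) := by
  have hf' : Differentiable ℝ (deriv f) :=
    ((contDiff_infty_iff_deriv.1 hf).2).differentiable (by simp)
  have hsecond (j : Fin N) : partialDeriv j (partialDeriv j ψ) y =
      2 * a * (deriv f (a * ‖y - x‖ ^ 2) +
        2 * a * deriv (deriv f) (a * ‖y - x‖ ^ 2) * (y - x) j ^ 2) := by
    have hcoord : HasFDerivAt (fun y : Space N => (y - x) j)
        (EuclideanSpace.proj j : StrongDual ℝ (Space N)) y :=
      (EuclideanSpace.proj j : StrongDual ℝ (Space N)).hasFDerivAt.sub_const (x j)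
    have hprod := ((hasFDerivAt_comp_mul_norm_sq hf' a x y).mul hcoord).const_mul (2 * a)
    rw [partialDeriv_apply, funext (partialDeriv_radial (hf.differentiable (by simp)) hψ j)]
    refine (congrArg (· (basisVec j)) hprod.fderiv).trans ?_
    have hjj : (basisVec j : Space N) j = 1 := by simp [basisVec]
    simp only [smul_apply, add_apply, innerSL_basisVec,
      smul_eq_mul, PiLp.proj_apply, hjj]
    ring
  simp only [hsecond, ← Finset.mul_sum, Finset.sum_add_distrib, ← EuclideanSpace.real_norm_sq_eq,
    Finset.sum_const, Finset.card_univ, Fintype.card_fin, nsmul_eq_mul]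
  ring

theorem exists_testFunction_eq_bumpProfile {x : Space N} {a : ℝ} (ha : 0 < a)
    (hball : Metric.closedBall x a⁻¹ ⊆ Ω) :
    ∃ ψ : 𝓓(Ω, ℝ), ∀ y, ψ y = bumpProfile (a ^ 2 * ‖y - x‖ ^ 2) := by
  have hzero {y : Space N} (hy : y ∉ Metric.closedBall x a⁻¹) :
      bumpProfile (a ^ 2 * ‖y - x‖ ^ 2) = 0 := by
    rw [Metric.mem_closedBall, not_le, dist_eq_norm, inv_lt_iff_one_lt_mul₀' ha] at hy
    rw [← mul_pow]
    exact bumpProfile_eq_zero (one_le_pow₀ hy.le)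
  refine ⟨⟨fun y => bumpProfile (a ^ 2 * ‖y - x‖ ^ 2), ?_, ?_, ?_⟩, fun _ => rfl⟩
  · exact contDiff_bumpProfile.comp
      (contDiff_const.mul ((contDiff_id.sub contDiff_const).norm_sq ℝ))
  · exact HasCompactSupport.intro (isCompact_closedBall x a⁻¹) fun y => hzero
  · exact (closure_minimal (Function.support_subset_iff'.2 fun y => hzero)
      Metric.isClosed_closedBall).trans hball

end Radial

section MeanValue

theorem hasDerivAt_integral_comp_exp_mul {α : Type*} [MeasurableSpace α] {μ : Measure α}
    {f : ℝ → ℝ} (hf : ContDiff ℝ 1 f) (hf₁ : ∀ t, 1 ≤ t → f t = 0) {g u : α → ℝ}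
    (hg : Measurable g) (hg₀ : ∀ y, 0 ≤ g y) (hu : Integrable u μ) (s : ℝ) :
    Integrable (fun y => f (Real.exp (2 * s) * g y) * u y) μ ∧
    Integrable (fun y => Real.exp (2 * s) * g y * deriv f (Real.exp (2 * s) * g y) * u y) μ ∧
    HasDerivAt (fun s => ∫ y, f (Real.exp (2 * s) * g y) * u y ∂μ)
      (2 * ∫ y, Real.exp (2 * s) * g y * deriv f (Real.exp (2 * s) * g y) * u y ∂μ) s := by
  have hτ (s : ℝ) (y : α) : 0 ≤ Real.exp (2 * s) * g y := mul_nonneg (Real.exp_nonneg _) (hg₀ y)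
  have hf' : Continuous fun t => t * deriv f t := continuous_id.mul (hf.continuous_deriv le_rfl)
  have hf'₁ (t : ℝ) (ht : 1 ≤ t) : t * deriv f t = 0 := by
    rw [deriv_eq_zero_of_forall_ge (hf.differentiable one_ne_zero) hf₁ ht, mul_zero]
  obtain ⟨C, hC⟩ := exists_forall_nonneg_abs_le hf.continuous hf₁
  obtain ⟨C', hC'⟩ := exists_forall_nonneg_abs_le hf' hf'₁
  have hmeas {h : ℝ → ℝ} (hh : Continuous h) (s : ℝ) :
      AEStronglyMeasurable (fun y => h (Real.exp (2 * s) * g y)) μ :=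
    (hh.measurable.comp (hg.const_mul _)).aestronglyMeasurable
  have hint : Integrable (fun y => f (Real.exp (2 * s) * g y) * u y) μ :=
    hu.bdd_mul (hmeas hf.continuous s) (.of_forall fun y => hC _ (hτ s y))
  have hint' : Integrable
      (fun y => Real.exp (2 * s) * g y * deriv f (Real.exp (2 * s) * g y) * u y) μ :=
    hu.bdd_mul (hmeas hf' s) (.of_forall fun y => hC' _ (hτ s y))
  refine ⟨hint, hint', ?_⟩
  rw [← integral_const_mul]
  refine (hasDerivAt_integral_of_dominated_loc_of_deriv_le (bound := fun y => 2 * (C' * |u y|))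
    (F' := fun s y => 2 * (Real.exp (2 * s) * g y * deriv f (Real.exp (2 * s) * g y) * u y))
    Filter.univ_mem (.of_forall fun s => (hmeas hf.continuous s).mul hu.aestronglyMeasurable)
    hint (hint'.const_mul 2).aestronglyMeasurable (.of_forall fun y s _ => ?_)
    ((hu.abs.const_mul C').const_mul 2) (.of_forall fun y s _ => ?_)).2
  · rw [Real.norm_eq_abs, abs_mul, abs_mul, abs_two]
    gcongr
    exact hC' _ (hτ s y)
  · have hexp := (((hasDerivAt_id s).const_mul 2).exp.mul_const (g y))
    have hcomp := ((hf.differentiable one_ne_zero _).hasDerivAt.comp s hexp).mul_const (u y)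
    exact hcomp.congr_deriv (by simp only [id, mul_one]; ring)

variable {N : ℕ} {Ω : Opens (Space N)}

/-- `u` is superharmonic on `Ω` in the sense of distributions: `∫ u Δψ ≤ 0` for every
nonnegative test function `ψ`. -/
def IsWeaklySuperharmonic (Ω : Opens (Space N)) (u : Space N → ℝ) : Prop :=
  ∀ ψ : 𝓓(Ω, ℝ), (∀ x, 0 ≤ ψ x) →
    ∫ x in (Ω : Set (Space N)), (∑ j, partialDeriv j (partialDeriv j ψ) x) * u x ≤ 0

/-- Up to a constant factor depending only on `N`, the mean of `-u` over the ball with centre `x`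
and radius `exp (-s)`, with the radial weight given by the derivative of `bumpProfile`. Radii are
parametrized by `exp (-s)` because the monotonicity formula is autonomous in `s`. -/
noncomputable def weightedMean (Ω : Opens (Space N)) (u : Space N → ℝ) (x : Space N) (s : ℝ) : ℝ :=
  Real.exp (N * s) *
    ∫ y in (Ω : Set (Space N)), deriv bumpProfile (Real.exp (2 * s) * ‖y - x‖ ^ 2) * u y

theorem weightedMean_nonpos {u : Space N → ℝ}
    (hu₀ : 0 ≤ᵐ[volume.restrict (Ω : Set (Space N))] u) (x : Space N) (s : ℝ) :
    weightedMean Ω u x s ≤ 0 := by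
  refine mul_nonpos_of_nonneg_of_nonpos (Real.exp_nonneg _) (integral_nonpos_of_ae ?_)
  filter_upwards [hu₀] with y hy
  exact mul_nonpos_of_nonpos_of_nonneg (deriv_bumpProfile_nonpos _) hy

theorem hasDerivAt_weightedMean {u : Space N → ℝ} (hu : IntegrableOn u Ω) (x : Space N) (s : ℝ)
    {ψ : 𝓓(Ω, ℝ)} (hψ : ∀ y, ψ y = bumpProfile (Real.exp (2 * s) * ‖y - x‖ ^ 2)) :
    HasDerivAt (weightedMean Ω u x) (Real.exp (N * s) * ((2 * Real.exp (2 * s))⁻¹ *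
      ∫ y in (Ω : Set (Space N)), (∑ j, partialDeriv j (partialDeriv j ψ) y) * u y)) s := by
  have hmeas : Measurable fun y : Space N => ‖y - x‖ ^ 2 := by fun_prop
  obtain ⟨hint, hint', hderiv⟩ := hasDerivAt_integral_comp_exp_mul
    (contDiff_deriv_bumpProfile.of_le (by simp)) (fun _ => deriv_bumpProfile_eq_zero) hmeas
    (fun y => sq_nonneg _) hu s
  have hexp : HasDerivAt (fun s : ℝ => Real.exp (N * s)) (Real.exp (N * s) * N) s := by
    simpa using ((hasDerivAt_id s).const_mul (N : ℝ)).exp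
  have hlaplacian (y : Space N) := sum_partialDeriv_partialDeriv_radial contDiff_bumpProfile hψ y
  refine (hexp.mul hderiv).congr_deriv ?_
  simp only [hlaplacian, mul_assoc (2 * Real.exp (2 * s))]
  rw [integral_const_mul, inv_mul_cancel_left₀ (by positivity)]
  simp only [add_mul, mul_assoc (N : ℝ), mul_assoc (2 : ℝ)]
  rw [integral_add (hint.const_mul _) (hint'.const_mul _), integral_const_mul, integral_const_mul]
  ring

theorem antitoneOn_weightedMean {u : Space N → ℝ} (hu : IntegrableOn u Ω)
    (hsuper : IsWeaklySuperharmonic Ω u) {x : Space N} {s₀ : ℝ}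
    (hball : Metric.closedBall x (Real.exp (-s₀)) ⊆ Ω) :
    AntitoneOn (weightedMean Ω u x) (Set.Ici s₀) := by
  have hderiv (s : ℝ) (hs : s₀ ≤ s) : ∃ d ≤ 0, HasDerivAt (weightedMean Ω u x) d s := by
    have hball' : Metric.closedBall x (Real.exp s)⁻¹ ⊆ Ω := by
      rw [← Real.exp_neg]
      exact (Metric.closedBall_subset_closedBall (by gcongr)).trans hball
    obtain ⟨ψ, hψ⟩ := exists_testFunction_eq_bumpProfile (Real.exp_pos s) hball'
    have hψ₀ (y : Space N) : 0 ≤ ψ y := hψ y ▸ bumpProfile_nonneg _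
    have hexp : Real.exp s ^ 2 = Real.exp (2 * s) := by rw [← Real.exp_nat_mul, Nat.cast_two]
    exact ⟨_, mul_nonpos_of_nonneg_of_nonpos (by positivity)
      (mul_nonpos_of_nonneg_of_nonpos (by positivity) (hsuper ψ hψ₀)),
      hasDerivAt_weightedMean hu x s fun y => hexp ▸ hψ y⟩
  choose! d hd hderiv using hderiv
  refine antitoneOn_of_deriv_nonpos (convex_Ici s₀)
    (fun s hs => (hderiv s hs).continuousAt.continuousWithinAt) ?_ ?_ <;>
    rw [interior_Ici] <;> intro s hs
  · exact (hderiv s (le_of_lt hs)).differentiableAt.differentiableWithinAt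
  · exact (hderiv s (le_of_lt hs)).deriv.trans_le (hd s (le_of_lt hs))

theorem abs_deriv_bumpProfile_le_indicator {C : ℝ} (hC : ∀ t, 0 ≤ t → |deriv bumpProfile t| ≤ C)
    {E : Type*} [SeminormedAddCommGroup E] (x y : E) (s : ℝ) :
    |deriv bumpProfile (Real.exp (2 * s) * ‖y - x‖ ^ 2)| ≤
      (Metric.closedBall x (Real.exp (-s))).indicator (fun _ => C) y := by
  by_cases hy : y ∈ Metric.closedBall x (Real.exp (-s))
  · rw [Set.indicator_of_mem hy]
    exact hC _ (by positivity)
  · rw [Set.indicator_of_notMem hy, deriv_bumpProfile_eq_zero, abs_zero]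
    rw [Metric.mem_closedBall, not_le, dist_eq_norm, Real.exp_neg,
      inv_lt_iff_one_lt_mul₀' (Real.exp_pos s)] at hy
    rw [show 2 * s = (2 : ℕ) * s by norm_num, Real.exp_nat_mul, ← mul_pow]
    exact one_le_pow₀ hy.le

theorem exists_neg_weightedMean_le_average (Ω : Opens (Space N)) :
    ∃ C : ℝ, ∀ {u : Space N → ℝ}, IntegrableOn u Ω →
      0 ≤ᵐ[volume.restrict (Ω : Set (Space N))] u → ∀ (x : Space N) (s : ℝ),
      -weightedMean Ω u x s ≤
        C * ⨍ y in Metric.closedBall x (Real.exp (-s)), (Ω : Set (Space N)).indicator u y := by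
  have hcont : Continuous (deriv bumpProfile) := contDiff_deriv_bumpProfile.continuous
  obtain ⟨C, hC⟩ := exists_forall_nonneg_abs_le hcont fun t => deriv_bumpProfile_eq_zero
  refine ⟨C * volume.real (Metric.ball (0 : Space N) 1), fun {u} hu hu₀ x s => ?_⟩
  set B := Metric.closedBall x (Real.exp (-s)) with hB
  have hvol : volume.real B =
      (Real.exp (N * s))⁻¹ * volume.real (Metric.ball (0 : Space N) 1) := by
    rw [hB, Measure.addHaar_real_closedBall _ _ (Real.exp_nonneg _), finrank_euclideanSpace_fin,
      ← Real.exp_nat_mul, mul_neg, Real.exp_neg]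
  have hunit : 0 < volume.real (Metric.ball (0 : Space N) 1) :=
    ENNReal.toReal_pos (Metric.measure_ball_pos _ _ one_pos).ne' measure_ball_lt_top.ne
  have hintegral : -∫ y in (Ω : Set (Space N)),
      deriv bumpProfile (Real.exp (2 * s) * ‖y - x‖ ^ 2) * u y ≤
      C * ∫ y in B, (Ω : Set (Space N)).indicator u y := by
    rw [setIntegral_indicator Ω.isOpen.measurableSet, Set.inter_comm,
      ← setIntegral_indicator Metric.isClosed_closedBall.measurableSet, ← integral_const_mul,
      ← integral_neg]
    refine integral_mono_of_nonneg ?_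
      ((hu.indicator Metric.isClosed_closedBall.measurableSet).const_mul _) ?_ <;>
      filter_upwards [hu₀] with y hy
    · exact neg_nonneg.2 (mul_nonpos_of_nonpos_of_nonneg (deriv_bumpProfile_nonpos _) hy)
    · rw [← neg_mul, ← Set.indicator_const_mul]
      refine (mul_le_mul_of_nonneg_right ((neg_le_abs _).trans
        (abs_deriv_bumpProfile_le_indicator hC x y s)) hy).trans_eq ?_
      rw [← Set.indicator_mul_left]
  rw [setAverage_eq, hvol, weightedMean, smul_eq_mul]
  calc _ = Real.exp (N * s) * -∫ y in (Ω : Set (Space N)),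
          deriv bumpProfile (Real.exp (2 * s) * ‖y - x‖ ^ 2) * u y := by ring
    _ ≤ Real.exp (N * s) * (C * ∫ y in B, (Ω : Set (Space N)).indicator u y) := by gcongr
    _ = _ := by field_simp

end MeanValue

section ZeroOne

theorem ae_restrict_of_subset_sUnion {X : Type*} [TopologicalSpace X] [SecondCountableTopology X]
    [MeasurableSpace X] [OpensMeasurableSpace X] {μ : Measure X} {p : X → Prop} {Ω : Set X}
    (hΩ : MeasurableSet Ω) {C : Set (Set X)}
    (hC : ∀ V ∈ C, IsOpen V ∧ ∀ᵐ y ∂(μ.restrict V), p y) (hsub : Ω ⊆ ⋃₀ C) :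
    ∀ᵐ x ∂(μ.restrict Ω), p x := by
  rw [ae_restrict_iff' hΩ]
  refine measure_null_of_locally_null _ fun x hx => ?_
  obtain ⟨V, hVC, hxV⟩ := hsub (Classical.not_imp.1 hx).1
  obtain ⟨hVopen, hV⟩ := hC V hVC
  rw [ae_restrict_iff' hVopen.measurableSet] at hV
  refine ⟨_, inter_mem_nhdsWithin _ (hVopen.mem_nhds hxV), measure_mono_null ?_ hV⟩
  exact fun y hy h => hy.1 fun _ => h hy.2

theorem ae_notMem_or_ae_mem_of_isPreconnected {X : Type*} [PseudoMetricSpace X]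
    [SecondCountableTopology X] [MeasurableSpace X] [OpensMeasurableSpace X] {μ : Measure X}
    [μ.IsOpenPosMeasure] {Ω s : Set X} (hΩ : IsOpen Ω) (hconn : IsPreconnected Ω)
    (hprop : ∀ᵐ x ∂(μ.restrict Ω), x ∈ s → ∀ r, 0 < r → Metric.closedBall x r ⊆ Ω →
      ∀ᵐ y ∂(μ.restrict (Metric.ball x r)), y ∈ s) :
    (∀ᵐ x ∂(μ.restrict Ω), x ∉ s) ∨ ∀ᵐ x ∂(μ.restrict Ω), x ∈ s := by
  rw [or_iff_not_imp_left]
  intro hs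
  let Z : Set X := ⋃₀ {V | IsOpen V ∧ ∀ᵐ y ∂(μ.restrict V), y ∈ s}
  have hdense {x : X} {r : ℝ} (hxr : Metric.closedBall x (r + r) ⊆ Ω)
      (h : ∃ᵐ y ∂(μ.restrict (Metric.ball x r)), y ∈ s) : x ∈ Z := by
    have hsub : Metric.ball x r ⊆ Ω := fun z hz => hxr (Metric.closedBall_subset_closedBall
      (by linarith [Metric.pos_of_mem_ball hz]) (Metric.ball_subset_closedBall hz))
    obtain ⟨y, ⟨hys, hyr⟩, hy⟩ := (h.and_eventually
      (ae_restrict_mem Metric.isOpen_ball.measurableSet)).and_eventually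
      (ae_restrict_of_ae_restrict_of_subset hsub hprop) |>.exists
    exact ⟨Metric.ball y r, ⟨Metric.isOpen_ball, hy hys r (Metric.pos_of_mem_ball hyr)
      ((Metric.closedBall_subset_closedBall' (by gcongr; exact le_of_lt hyr)).trans hxr)⟩,
      Metric.mem_ball_comm.1 hyr⟩
  have hmeets : (Ω ∩ Z).Nonempty := by
    obtain ⟨x, ⟨hxs, hxΩ⟩, hx⟩ := ((Filter.not_eventually.1 hs).and_eventually
      (ae_restrict_mem hΩ.measurableSet)).and_eventually hprop |>.exists
    obtain ⟨r, hr, hxr⟩ := Metric.nhds_basis_closedBall.mem_iff.1 (hΩ.mem_nhds hxΩ)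
    exact ⟨x, hxΩ, Metric.ball x r, ⟨Metric.isOpen_ball, hx (not_not.1 hxs) r hr hxr⟩,
      Metric.mem_ball_self hr⟩
  have hclosed : closure Z ∩ Ω ⊆ Z := by
    rintro x ⟨hxZ, hxΩ⟩
    obtain ⟨r, hr, hxr⟩ := Metric.nhds_basis_closedBall.mem_iff.1 (hΩ.mem_nhds hxΩ)
    refine hdense (r := r / 2) (by rwa [add_halves]) fun hnot => ?_
    obtain ⟨z, hzball, V, ⟨hVopen, hV⟩, hzV⟩ :=
      mem_closure_iff_nhds.1 hxZ _ (Metric.ball_mem_nhds x (half_pos hr))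
    have hopen : IsOpen (Metric.ball x (r / 2) ∩ V) := Metric.isOpen_ball.inter hVopen
    refine (hopen.measure_pos μ ⟨z, hzball, hzV⟩).ne' ?_
    rw [← Measure.restrict_eq_zero, ← ae_eq_bot, ← Filter.eventually_false_iff_eq_bot]
    filter_upwards [ae_restrict_of_ae_restrict_of_subset Set.inter_subset_left hnot,
      ae_restrict_of_ae_restrict_of_subset Set.inter_subset_right hV] with y h h' using h h'
  have hsub := hconn.subset_of_closure_inter_subset (isOpen_sUnion fun V hV => hV.1) hmeets hclosed
  exact ae_restrict_of_subset_sUnion hΩ.measurableSet (fun V hV => hV) hsub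

end ZeroOne

section StrongMaximumPrinciple

variable {N : ℕ} {Ω : Opens (Space N)} {u : Space N → ℝ}

theorem ae_tendsto_weightedMean (hu : IntegrableOn u Ω)
    (hu₀ : 0 ≤ᵐ[volume.restrict (Ω : Set (Space N))] u) :
    ∀ᵐ x ∂(volume.restrict (Ω : Set (Space N))), u x = 0 →
      Filter.Tendsto (weightedMean Ω u x) Filter.atTop (nhds 0) := by
  obtain ⟨C, hC⟩ := exists_neg_weightedMean_le_average Ω
  have hradius : Filter.Tendsto (fun s => Real.exp (-s)) Filter.atTop (nhdsWithin 0 (Set.Ioi 0)) :=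
    tendsto_nhdsWithin_iff.2
      ⟨Real.tendsto_exp_neg_atTop_nhds_zero, .of_forall fun s => Real.exp_pos _⟩
  have hdiff := IsUnifLocDoublingMeasure.ae_tendsto_average (μ := (volume : Measure (Space N)))
    (integrable_indicator_iff Ω.isOpen.measurableSet |>.2 hu).locallyIntegrable 1
  filter_upwards [ae_restrict_of_ae hdiff] with x hx hux
  have haverage := (hx (fun _ => x) _ hradius (.of_forall fun s => by
    rw [one_mul]
    exact Metric.mem_closedBall_self (Real.exp_nonneg _))).const_mul C
  rw [Set.indicator_apply_eq_zero.2 fun _ => hux, mul_zero] at haverage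
  refine tendsto_of_tendsto_of_tendsto_of_le_of_le (neg_zero (G := ℝ) ▸ haverage.neg)
    tendsto_const_nhds (fun s => neg_le.1 (hC hu hu₀ x s)) fun s => weightedMean_nonpos hu₀ x s

theorem ae_eq_zero_on_ball_of_weightedMean_eq_zero (hu : IntegrableOn u Ω)
    (hu₀ : 0 ≤ᵐ[volume.restrict (Ω : Set (Space N))] u) {x : Space N} {s : ℝ}
    (hball : Metric.ball x (Real.exp (-s)) ⊆ Ω) (hW : weightedMean Ω u x s = 0) :
    ∀ᵐ y ∂(volume.restrict (Metric.ball x (Real.exp (-s)))), u y = 0 := by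
  have hmeas : Measurable fun y : Space N => ‖y - x‖ ^ 2 := by fun_prop
  have hint := (hasDerivAt_integral_comp_exp_mul (contDiff_deriv_bumpProfile.of_le (by simp))
    (fun _ => deriv_bumpProfile_eq_zero) hmeas (fun y => sq_nonneg _) hu s).1
  have hsign : 0 ≤ᵐ[volume.restrict (Ω : Set (Space N))] fun y =>
      -(deriv bumpProfile (Real.exp (2 * s) * ‖y - x‖ ^ 2) * u y) := by
    filter_upwards [hu₀] with y hy
    exact neg_nonneg.2 (mul_nonpos_of_nonpos_of_nonneg (deriv_bumpProfile_nonpos _) hy)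
  have hzero : ∫ y in (Ω : Set (Space N)),
      -(deriv bumpProfile (Real.exp (2 * s) * ‖y - x‖ ^ 2) * u y) = 0 := by
    rw [integral_neg, neg_eq_zero]
    exact (mul_eq_zero.1 hW).resolve_left (Real.exp_ne_zero _)
  have hae := ae_restrict_of_ae_restrict_of_subset hball
    ((integral_eq_zero_iff_of_nonneg_ae hsign hint.neg).1 hzero)
  filter_upwards [hae, ae_restrict_mem Metric.isOpen_ball.measurableSet] with y hy hyball
  refine (mul_eq_zero.1 (neg_eq_zero.1 hy)).resolve_left (deriv_bumpProfile_neg ?_).ne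
  rw [Metric.mem_ball, dist_eq_norm, Real.exp_neg, ← one_div,
    lt_div_iff₀' (Real.exp_pos s)] at hyball
  rw [show 2 * s = (2 : ℕ) * s by norm_num, Real.exp_nat_mul, ← mul_pow]
  exact pow_lt_one₀ (by positivity) hyball two_ne_zero

theorem ae_eq_zero_on_ball_of_eq_zero (hu : IntegrableOn u Ω)
    (hu₀ : 0 ≤ᵐ[volume.restrict (Ω : Set (Space N))] u) (hsuper : IsWeaklySuperharmonic Ω u) :
    ∀ᵐ x ∂(volume.restrict (Ω : Set (Space N))), u x = 0 →
      ∀ r, 0 < r → Metric.closedBall x r ⊆ Ω →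
        ∀ᵐ y ∂(volume.restrict (Metric.ball x r)), u y = 0 := by
  filter_upwards [ae_tendsto_weightedMean hu hu₀] with x hx hux r hr hball
  obtain ⟨s, rfl⟩ : ∃ s, Real.exp (-s) = r := ⟨-Real.log r, by rw [neg_neg, Real.exp_log hr]⟩
  refine ae_eq_zero_on_ball_of_weightedMean_eq_zero hu hu₀
    (Metric.ball_subset_closedBall.trans hball) (le_antisymm (weightedMean_nonpos hu₀ x s) ?_)
  refine le_of_tendsto (hx hux) ?_
  filter_upwards [Filter.eventually_ge_atTop s] with t hst
  exact antitoneOn_weightedMean hu hsuper hball Set.self_mem_Ici hst hst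

theorem ae_pos_or_ae_eq_zero (hconn : IsPreconnected (Ω : Set (Space N))) (hu : IntegrableOn u Ω)
    (hu₀ : 0 ≤ᵐ[volume.restrict (Ω : Set (Space N))] u) (hsuper : IsWeaklySuperharmonic Ω u) :
    (∀ᵐ x ∂(volume.restrict (Ω : Set (Space N))), 0 < u x) ∨
      ∀ᵐ x ∂(volume.restrict (Ω : Set (Space N))), u x = 0 := by
  refine (ae_notMem_or_ae_mem_of_isPreconnected Ω.isOpen hconn (s := {x | u x = 0})
    (ae_eq_zero_on_ball_of_eq_zero hu hu₀ hsuper)).imp_left fun hne => ?_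
  filter_upwards [hu₀, hne] with x hx hxne using lt_of_le_of_ne hx (Ne.symm hxne)

end StrongMaximumPrinciple

section PositiveEigenfunction

variable {N : ℕ} {Ω : Opens (Space N)}

theorem isWeaklySuperharmonic_of_mem_laplacianGraph {u f : L2 Ω ℝ}
    (h : (u, f) ∈ laplacianGraph Ω ℝ)
    (hf : ∀ᵐ x ∂(volume.restrict (Ω : Set (Space N))), 0 ≤ f x) : IsWeaklySuperharmonic Ω u := by
  intro ψ hψ
  obtain ⟨g, hg, hweak⟩ := h
  have hparts (j : Fin N) :
      ∫ x in (Ω : Set (Space N)), partialDeriv j (partialDeriv j ψ) x * u x =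
        -inner ℝ (g j) (testToL2 Ω ℝ (partialDeriv j ψ)) := by
    have h := hg.1 j (partialDeriv j ψ)
    simp only [lineDeriv_testFunction, smul_eq_mul] at h
    rw [partialDeriv, h, inner_testToL2]
    simp only [mul_comm]
  calc ∫ x in (Ω : Set (Space N)), (∑ j, partialDeriv j (partialDeriv j ψ) x) * u x
      = ∑ j, ∫ x in (Ω : Set (Space N)), partialDeriv j (partialDeriv j ψ) x * u x := by
        simp only [Finset.sum_mul]
        exact integral_finsetSum _ fun j _ =>
          integrable_testFunction_smul Ω ℝ (partialDeriv j (partialDeriv j ψ)) u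
    _ = -inner ℝ f (testToL2 Ω ℝ ψ) := by
        simp only [hparts, Finset.sum_neg_distrib]
        exact congrArg Neg.neg (hweak _ (testWithGradient_mem_H10 Ω ℝ ψ))
    _ ≤ 0 := by
        rw [inner_testToL2, Left.neg_nonpos_iff]
        refine integral_nonneg_of_ae ?_
        filter_upwards [hf] with x hx using mul_nonneg hx (hψ x)

theorem exists_pos_eigenfunction (hbdd : Bornology.IsBounded (Ω : Set (Space N)))
    (hconn : IsConnected (Ω : Set (Space N))) :
    ∃ φ : L2 Ω ℝ, φ ≠ 0 ∧ (∀ᵐ x ∂(volume.restrict (Ω : Set (Space N))), 0 < φ x) ∧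
      (φ, firstEigenvalue Ω • φ) ∈ laplacianGraph Ω ℝ := by
  have : IsFiniteMeasure (volume.restrict (Ω : Set (Space N))) :=
    isFiniteMeasure_restrict.2 hbdd.measure_lt_top.ne
  obtain ⟨hfirst, φ, hφ, hφ₀, hgraph⟩ := exists_nonneg_eigenfunction hbdd hconn.nonempty
  have hφae := (Lp.coeFn_nonneg φ).2 hφ
  have hsuper : IsWeaklySuperharmonic Ω φ := by
    refine isWeaklySuperharmonic_of_mem_laplacianGraph hgraph ?_
    filter_upwards [hφae, Lp.coeFn_smul (firstEigenvalue Ω) φ] with x hx hsmul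
    rw [hsmul]
    exact mul_nonneg hfirst hx
  have hint : Integrable φ (volume.restrict (Ω : Set (Space N))) :=
    (Lp.memLp φ).integrable (by norm_num)
  exact ⟨φ, hφ₀, (ae_pos_or_ae_eq_zero hconn.isPreconnected hint hφae hsuper).resolve_right
    fun h => hφ₀ (Lp.eq_zero_iff_ae_eq_zero.2 h), hgraph⟩

end PositiveEigenfunction

section Matrix

variable {n : Type*} [Fintype n] [DecidableEq n] {A : Matrix n n ℝ} {l : ℝ} {v : n → ℝ}

theorem re_le_of_mem_spectrum_of_mulVec_lt (hA : ∀ i j, i ≠ j → 0 ≤ A i j) (hv : ∀ i, 0 ≤ v i)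
    (h : ∀ i, A.mulVec v i < l * v i) {μ : ℂ} (hμ : μ ∈ spectrum ℂ (A.map Complex.ofReal)) :
    μ.re ≤ l := by
  have hsum (i : n) : ∑ j ∈ Finset.univ.erase i, A i j * v j < (l - A i i) * v i := by
    have := h i
    rw [Matrix.mulVec, dotProduct, ← Finset.add_sum_erase _ _ (Finset.mem_univ i)] at this
    linarith
  have hpos (i : n) : 0 < v i := by
    refine (hv i).lt_of_ne' fun h0 => (hsum i).not_ge ?_
    rw [h0, mul_zero]
    exact Finset.sum_nonneg fun j hj =>
      mul_nonneg (hA i j (Finset.ne_of_mem_erase hj).symm) (hv j)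
  -- Conjugating by `diag v` does not change the spectrum, and then Gershgorin's discs do the job.
  let V : (Matrix n n ℂ)ˣ :=
    ⟨.diagonal fun i => v i, .diagonal fun i => (v i : ℂ)⁻¹, by simp [(hpos _).ne'],
      by simp [(hpos _).ne']⟩
  rw [← spectrum.units_conjugate' (u := V), ← Matrix.spectrum_toLin',
    ← Module.End.hasEigenvalue_iff_mem_spectrum] at hμ
  obtain ⟨k, hk⟩ := eigenvalue_mem_ball hμ
  have hentry (j : n) : (V⁻¹ * A.map Complex.ofReal * V : Matrix n n ℂ) k j =
      ((v k)⁻¹ * (A k j * v j) : ℝ) := by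
    change (Matrix.diagonal _ * A.map Complex.ofReal * Matrix.diagonal _ : Matrix n n ℂ) k j = _
    simp [mul_assoc]
  have hnorm : ∑ j ∈ Finset.univ.erase k, ‖(((v k)⁻¹ * (A k j * v j) : ℝ) : ℂ)‖ ≤ l - A k k := by
    have hterm : ∀ j ∈ Finset.univ.erase k,
        ‖(((v k)⁻¹ * (A k j * v j) : ℝ) : ℂ)‖ = (v k)⁻¹ * (A k j * v j) := fun j hj => by
      have := hA k j (Finset.ne_of_mem_erase hj).symm
      exact Complex.norm_of_nonneg (mul_nonneg (inv_nonneg.2 (hv k)) (mul_nonneg this (hv j)))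
    rw [Finset.sum_congr rfl hterm, ← Finset.mul_sum, inv_mul_le_iff₀ (hpos k), mul_comm]
    exact (hsum k).le
  simp only [hentry] at hk
  rw [mul_comm (A k k), inv_mul_cancel_left₀ (hpos k).ne', mem_closedBall_iff_norm] at hk
  have := (Complex.re_le_norm _).trans (hk.trans hnorm)
  simp only [Complex.sub_re, Complex.ofReal_re] at this
  linarith

end Matrix

theorem spectralBound_le_of_mulVec_lt {M : ℕ} (hM : 0 < M) {D : Matrix (Fin M) (Fin M) ℝ}
    (hD : QuasiNonneg D) {l : ℝ} {v : Fin M → ℝ} (hv : ∀ i, 0 ≤ v i)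
    (h : ∀ i, D.mulVec v i < l * v i) : spectralBound D ≤ l := by
  have : Nonempty (Fin M) := ⟨⟨0, hM⟩⟩
  refine csSup_le ((spectrum.nonempty_of_isAlgClosed_of_finiteDimensional ℂ _).image _) ?_
  rintro _ ⟨μ, hμ, rfl⟩
  exact re_le_of_mem_spectrum_of_mulVec_lt hD hv h hμ

section Components

variable {N M : ℕ} {Ω : Opens (Space N)}

/-- The `i`-th component of a vector-valued `L²` function, as a continuous linear map. -/
noncomputable def component (i : Fin M) : L2 Ω (Space M) →L[ℝ] L2 Ω ℝ :=
  (EuclideanSpace.proj i : Space M →L[ℝ] ℝ).compLpL 2 (volume.restrict (Ω : Set (Space N)))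

theorem coeFn_component (i : Fin M) (u : L2 Ω (Space M)) :
    ∀ᵐ x ∂(volume.restrict (Ω : Set (Space N))), component i u x = u x i :=
  (EuclideanSpace.proj i : Space M →L[ℝ] ℝ).coeFn_compLp u

theorem eq_zero_of_forall_component_eq_zero {u : L2 Ω (Space M)} (h : ∀ i, component i u = 0) :
    u = 0 := by
  rw [Lp.eq_zero_iff_ae_eq_zero]
  have hcomp : ∀ᵐ x ∂(volume.restrict (Ω : Set (Space N))), ∀ i, u x i = 0 := by
    refine ae_all_iff.2 fun i => ?_
    filter_upwards [coeFn_component i u, Lp.eq_zero_iff_ae_eq_zero.1 (h i)] with x hu hx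
    rw [← hu, hx, Pi.zero_apply]
  filter_upwards [hcomp] with x hx
  ext i
  exact hx i

theorem component_ae_nonneg {u : L2 Ω (Space M)} (hu : u ∈ cone Ω M) (i : Fin M) :
    ∀ᵐ x ∂(volume.restrict (Ω : Set (Space N))), 0 ≤ component i u x := by
  filter_upwards [hu, coeFn_component i u] with x hx hcomp
  rw [hcomp]
  exact hx i

theorem component_nemytskii (D : Matrix (Fin M) (Fin M) ℝ) (u : L2 Ω (Space M)) (i : Fin M) :
    component i (nemytskii Ω D u) = ∑ j, D i j • component j u := by
  ext1
  have hnem : ∀ᵐ x ∂(volume.restrict (Ω : Set (Space N))),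
      nemytskii Ω D u x = Matrix.toEuclideanCLM (𝕜 := ℝ) D (u x) :=
    (Matrix.toEuclideanCLM (𝕜 := ℝ) D).coeFn_compLp u
  have hsmul : ∀ᵐ x ∂(volume.restrict (Ω : Set (Space N))), ∀ j,
      (D i j • component j u : L2 Ω ℝ) x = D i j * u x j := by
    refine ae_all_iff.2 fun j => ?_
    filter_upwards [Lp.coeFn_smul (D i j) (component j u), coeFn_component j u] with x hx hcomp
    rw [hx, Pi.smul_apply, hcomp, smul_eq_mul]
  filter_upwards [hnem, hsmul, coeFn_component i (nemytskii Ω D u),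
    Lp.coeFn_finsetSum Finset.univ fun j => D i j • component j u] with x hnem hsmul hcomp hsum
  rw [hcomp, hnem, hsum, Finset.sum_apply]
  simp only [hsmul]
  rfl

/-- The function `x ↦ f x • c` obtained from a scalar `L²` function `f` and a vector `c`. -/
noncomputable def smulConst (f : L2 Ω ℝ) (c : Space M) : L2 Ω (Space M) :=
  (ContinuousLinearMap.toSpanSingleton ℝ c).compLp f

theorem component_smulConst (f : L2 Ω ℝ) (c : Space M) (i : Fin M) :
    component i (smulConst f c) = c i • f := by
  ext1
  filter_upwards [coeFn_component i (smulConst f c), Lp.coeFn_smul (c i) f,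
    (ContinuousLinearMap.toSpanSingleton ℝ c).coeFn_compLp f] with x hcomp hsmul hx
  rw [hcomp, hsmul, smulConst, hx, ContinuousLinearMap.toSpanSingleton_apply, PiLp.smul_apply,
    Pi.smul_apply, smul_eq_mul, smul_eq_mul, mul_comm]

theorem inner_smulConst_basisVec (u : L2 Ω (Space M)) (f : L2 Ω ℝ) (i : Fin M) :
    inner ℝ u (smulConst f (basisVec i)) = inner ℝ (component i u) f := by
  rw [L2.inner_def, L2.inner_def]
  refine integral_congr_ae ?_
  filter_upwards [coeFn_component i u,
    (ContinuousLinearMap.toSpanSingleton ℝ (basisVec i)).coeFn_compLp f] with x hcomp hx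
  rw [hcomp, smulConst, hx]
  simp [basisVec, inner_smul_right, EuclideanSpace.inner_single_right]

theorem smulConst_mem_cone {f : L2 Ω ℝ} {c : Space M}
    (hf : ∀ᵐ x ∂(volume.restrict (Ω : Set (Space N))), 0 ≤ f x) (hc : ∀ i, 0 ≤ c i) :
    smulConst f c ∈ cone Ω M := by
  filter_upwards [hf, (ContinuousLinearMap.toSpanSingleton ℝ c).coeFn_compLp f] with x hfx hx i
  rw [smulConst, hx]
  exact mul_nonneg hfx (hc i)

end Components

section System

variable {N M : ℕ} {Ω : Opens (Space N)} {l : ℝ} {φ : L2 Ω ℝ}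

/-- The vector in `ℝ^M` of the `L²` inner products of the components of `u` with `φ`. -/
noncomputable def componentInner (φ : L2 Ω ℝ) (u : L2 Ω (Space M)) : Fin M → ℝ :=
  fun i => inner ℝ (component i u) φ

theorem componentInner_add (u w : L2 Ω (Space M)) :
    componentInner φ (u + w) = componentInner φ u + componentInner φ w := by
  funext i
  simp only [componentInner, map_add, inner_add_left, Pi.add_apply]

theorem componentInner_nemytskii (D : Matrix (Fin M) (Fin M) ℝ) (u : L2 Ω (Space M)) :
    componentInner φ (nemytskii Ω D u) = D.mulVec (componentInner φ u) := by
  funext i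
  rw [componentInner, component_nemytskii, sum_inner]
  simp only [real_inner_smul_left]
  rfl

theorem componentInner_nonneg (hφ : ∀ᵐ x ∂(volume.restrict (Ω : Set (Space N))), 0 < φ x)
    {u : L2 Ω (Space M)} (hu : u ∈ cone Ω M) (i : Fin M) : 0 ≤ componentInner φ u i := by
  rw [componentInner, L2.inner_def]
  refine integral_nonneg_of_ae ?_
  filter_upwards [hφ, component_ae_nonneg hu i] with x hφx hux using mul_nonneg hφx.le hux

theorem eq_zero_of_componentInner_eq_zero
    (hφ : ∀ᵐ x ∂(volume.restrict (Ω : Set (Space N))), 0 < φ x) {u : L2 Ω (Space M)}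
    (hu : u ∈ cone Ω M) (h : componentInner φ u = 0) : u = 0 := by
  refine eq_zero_of_forall_component_eq_zero fun i => Lp.eq_zero_iff_ae_eq_zero.2 ?_
  have hnonneg : 0 ≤ᵐ[volume.restrict (Ω : Set (Space N))]
      fun x => inner ℝ (component i u x) (φ x) := by
    filter_upwards [hφ, component_ae_nonneg hu i] with x hφx hux using mul_nonneg hφx.le hux
  have hzero : ∫ x in (Ω : Set (Space N)), inner ℝ (component i u x) (φ x) = 0 := congrFun h i
  rw [integral_eq_zero_iff_of_nonneg_ae hnonneg (L2.integrable_inner _ _)] at hzero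
  filter_upwards [hzero, hφ] with x hx hφx
  exact (mul_eq_zero.1 hx).resolve_left hφx.ne'

theorem componentInner_eq_smul_of_mem_laplacianGraph (hφ : (φ, l • φ) ∈ laplacianGraph Ω ℝ)
    {u f : L2 Ω (Space M)} (hu : (u, f) ∈ laplacianGraph Ω (Space M)) :
    componentInner φ f = l • componentInner φ u := by
  funext i
  obtain ⟨g, hg, hφweak⟩ := hφ
  obtain ⟨G, hG, huweak⟩ := hu
  have hu_test := huweak _
    (compLp_mem_H10 (ContinuousLinearMap.toSpanSingleton ℝ (basisVec i)) hg)
  change ∑ j, inner ℝ (G j) (smulConst (g j) (basisVec i)) =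
    inner ℝ f (smulConst φ (basisVec i)) at hu_test
  have hφ_test := hφweak _ (compLp_mem_H10 (EuclideanSpace.proj i : Space M →L[ℝ] ℝ) hG)
  change ∑ j, inner ℝ (g j) (component i (G j)) = inner ℝ (l • φ) (component i u) at hφ_test
  simp only [inner_smulConst_basisVec] at hu_test
  calc inner ℝ (component i f) φ = ∑ j, inner ℝ (component i (G j)) (g j) := hu_test.symm
    _ = inner ℝ (l • φ) (component i u) := by
        rw [← hφ_test]
        exact Finset.sum_congr rfl fun j _ => real_inner_comm _ _
    _ = l * inner ℝ (component i u) φ := by rw [real_inner_smul_left, real_inner_comm]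

theorem mem_solutions_iff {D : Matrix (Fin M) (Fin M) ℝ} {w u : L2 Ω (Space M)} :
    u ∈ solutions Ω D w ↔ (u, nemytskii Ω D u + w) ∈ laplacianGraph Ω (Space M) := by
  rw [mem_laplacianGraph_iff]
  exact exists_congr fun _ => sub_eq_iff_eq_add'

theorem mulVec_componentInner_add (hφ : (φ, l • φ) ∈ laplacianGraph Ω ℝ)
    {D : Matrix (Fin M) (Fin M) ℝ} {w u : L2 Ω (Space M)} (hu : u ∈ solutions Ω D w) :
    D.mulVec (componentInner φ u) + componentInner φ w = l • componentInner φ u := by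
  rw [← componentInner_eq_smul_of_mem_laplacianGraph hφ (mem_solutions_iff.1 hu),
    componentInner_add, componentInner_nemytskii]

theorem solutions_zero_inter_cone (hφ : (φ, l • φ) ∈ laplacianGraph Ω ℝ)
    (hpos : ∀ᵐ x ∂(volume.restrict (Ω : Set (Space N))), 0 < φ x)
    {D : Matrix (Fin M) (Fin M) ℝ} (hl : l ∉ sigmaPlus D) :
    solutions Ω D 0 ∩ cone Ω M = {0} := by
  refine Set.eq_singleton_iff_unique_mem.2 ⟨⟨mem_solutions_iff.2 ?_, ?_⟩, ?_⟩
  · rw [map_zero, add_zero]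
    exact (laplacianGraph Ω (Space M)).zero_mem
  · filter_upwards [Lp.coeFn_zero (Space M) 2 (volume.restrict (Ω : Set (Space N)))] with x hx i
    rw [hx]
    rfl
  · rintro u ⟨hu, hcone⟩
    refine eq_zero_of_componentInner_eq_zero hpos hcone ?_
    by_contra hne
    have heigen := mulVec_componentInner_add hφ hu
    have hzero : componentInner φ (0 : L2 Ω (Space M)) = 0 := by
      funext i
      simp only [componentInner, map_zero, inner_zero_left, Pi.zero_apply]
    rw [hzero, add_zero] at heigen
    exact hl ⟨_, hne, componentInner_nonneg hpos hcone, heigen⟩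

theorem exists_mem_cone_solutions_inter_cone_eq_empty (hM : 0 < M) (hφ₀ : φ ≠ 0)
    (hφ : (φ, l • φ) ∈ laplacianGraph Ω ℝ)
    (hpos : ∀ᵐ x ∂(volume.restrict (Ω : Set (Space N))), 0 < φ x)
    {D : Matrix (Fin M) (Fin M) ℝ} (hD : QuasiNonneg D) (hl : l < spectralBound D) :
    ∃ w ∈ cone Ω M, solutions Ω D w ∩ cone Ω M = ∅ := by
  let c : Space M := WithLp.toLp 2 fun _ => 1
  have hw (i : Fin M) : 0 < componentInner φ (smulConst φ c) i := by
    rw [componentInner, component_smulConst, one_smul]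
    exact real_inner_self_pos.2 hφ₀
  refine ⟨smulConst φ c, smulConst_mem_cone (hpos.mono fun _ => le_of_lt) fun _ => zero_le_one,
    Set.eq_empty_iff_forall_notMem.2 ?_⟩
  rintro u ⟨hu, hcone⟩
  refine hl.not_ge (spectralBound_le_of_mulVec_lt hM hD (componentInner_nonneg hpos hcone) ?_)
  intro i
  calc D.mulVec (componentInner φ u) i
      < D.mulVec (componentInner φ u) i + componentInner φ (smulConst φ c) i :=
        lt_add_of_pos_right _ (hw i)
    _ = l * componentInner φ u i := congrFun (mulVec_componentInner_add hφ hu) i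

end System

end DirichletSystem

theorem mainTheorem9_general {N M : ℕ} (hM : 0 < M)
    (Ω : TopologicalSpace.Opens (EuclideanSpace ℝ (Fin N)))
    (hbdd : Bornology.IsBounded (Ω : Set (EuclideanSpace ℝ (Fin N))))
    (hconn : IsConnected (Ω : Set (EuclideanSpace ℝ (Fin N))))
    (D : Matrix (Fin M) (Fin M) ℝ) :
    (firstEigenvalue Ω ∉ sigmaPlus D → solutions Ω D 0 ∩ cone Ω M = {0}) ∧
      (QuasiNonneg D → firstEigenvalue Ω < spectralBound D →
        ∃ w ∈ cone Ω M, solutions Ω D w ∩ cone Ω M = ∅) := by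
  obtain ⟨φ, hφ₀, hpos, hφ⟩ := exists_pos_eigenfunction hbdd hconn
  exact ⟨solutions_zero_inter_cone hφ hpos,
    exists_mem_cone_solutions_inter_cone_eq_empty hM hφ₀ hφ hpos⟩

theorem mainTheorem9 {N M : ℕ} (hN : 0 < N) (hM : 0 < M)
    (Ω : TopologicalSpace.Opens (EuclideanSpace ℝ (Fin N)))
    (hbdd : Bornology.IsBounded (Ω : Set (EuclideanSpace ℝ (Fin N))))
    (hconn : IsConnected (Ω : Set (EuclideanSpace ℝ (Fin N))))
    (D : Matrix (Fin M) (Fin M) ℝ) (hD : QuasiNonneg D)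
    (hσ : firstEigenvalue Ω ∉ sigmaPlus D) :
    solutions Ω D 0 ∩ cone Ω M = {0} ∧
      (firstEigenvalue Ω < spectralBound D →
        ∃ w ∈ cone Ω M, solutions Ω D w ∩ cone Ω M = ∅) :=
  (mainTheorem9_general hM Ω hbdd hconn D).imp (· hσ) (· hD)
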